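/- **Setting.** Let $k,l\ge 1$, $m\ge 0$. Norms are Euclidean (for matrices: the induced norm), and $(y;w)$ denotes concatenation. Consider $$\dot y=A_1y+\tilde g_1(y,z,u),\qquad \dot z=A_2z+B_2u+\tilde g_2(y,z,u),\qquad y\in\mathbb R^k,\ z\in\mathbb R^l,\ u\in\mathbb R^m,$$ where $\tilde g_1,\tilde g_2$ are $C^2$ and vanish together with their first derivatives at the origin, and the feedback $K(y;z)=K_{11}z+K_{12}y+K_n(y)$ with $K_n$ of class $C^1$ and $K_n(0)=0$. Put $A_K=A_2+B_2K_{11}$, let $E$ satisfy $A_KE-EA_1+B_2K_{12}=0$, put $v=z-Ey$ and $K_1=[\,K_{12}+K_{11}E\;\;K_{11}\,]$. With the continuous feedback $u=K(y;z)$ the system reads $$\dot y=A_1y+g_1(y,v),\qquad \dot v=A_Kv+g_2(y,v).$$ Assume the hypotheses of the center manifold theorem: $g_1,g_2$ are $C^2$ and vanish with their first derivatives at $0$, the eigenvalues of $A_1$ have zero real parts and those of $A_K$ have negative real parts. Let $v=h(y)$, $\|y\|<\rho$, be a center manifold: $h$ is $C^1$, $h(0)=0$, $Dh(0)=0$, and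 a solution that starts on the graph of $h$ stays on it as long as $\|y\|<\rho$. Put $w=v-h(y)$. Assume that the origin of the reduced system $\dot y=A_1y+g_1(y,h(y))$ is locally asymptotically stable, that $A_1=0$, and that for some $p>1$ and $k_5,k_6>0$, in a neighbourhood of $y=0$, $$\|g_1(y,h(y))\|\le k_5\|y\|^p,\qquad y^\top g_1(y,h(y))\le -k_6\|y\|^{p+1}.$$ Let $P,Q\succ 0$ with $A_K^\top P+PA_K=-Q$, let $s_f\in(0,1)$ and $$0<\sigma\le\frac{(1-s_f)\lambda_{\min}(Q)}{2\|PB_2K_1\|}\,\frac{\sqrt{\lambda_{\min}(P)}}{\sqrt{\lambda_{\max}(P)}}$$ (no upper bound if $PB_2K_1=0$). Let $V(y,w)=\|y\|+\sqrt{w^\top Pw}$, $\alpha_1(r)=\min(1,\sqrt{\lambda_{\min}(P)})\,r$, $\alpha_2(r)=\sqrt2\max(1,\sqrt{\lambda_{\max}(P)})\,r$. For $\delta_{yw}>0$ and $r_s>0$ let $\mathcal B_r=\{\|(y;w)\|<r\}$, $S_1=\mathcal B_{\delta_{yw}}$, $S_v=\{(y;w)\in S_1: V(y,w)\le\alpha_1(\delta_{yw})\}$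 and $S_2=\mathcal B_{r_1}$ with $r_1=\alpha_2^{-1}(\alpha_1(r_s))$. **Implementation.** Starting at time $t_0$, let $t_1=\min\{t\ge t_0:(y(t);w(t))\in S_v\setminus S_2\}$ and, for $i\ge1$, $$t_{i+1}=\min\{t\ge t_i:\ \|e(t)\|\ge\sigma(\|w(t)\|+\|y(t)\|^{p+1})\ \text{and}\ (y(t);w(t))\in S_v\setminus S_2\},$$ where $e(t)=(y(t_i)-y(t);\,v(t_i)-v(t))$ (the next event does not occur if the set is empty). The input is $u=0$ on $[t_0,t_1)$ and $u=K(y(t_i);z(t_i))$ on $[t_i,t_{i+1})$, $i\ge1$. **Proposition.** For all sufficiently small $\delta_{yw}>0$ and all $r_s>0$ with $\mathcal B_{r_s}\subset S_v$: 1. From every initial state with $(y(t_0);w(t_0))\in S_v$ the event-triggered closed loop has an execution on $[t_0,\infty)$, and there is a $T_1\ge0$, independent of $t_0$ and of the execution, such that every execution with $(y(t_0);w(t_0))\in S_v$ satisfies $(y(t);w(t))\in\mathcal B_{r_s}$ for all $t\ge t_0+T_1$ at which it is defined. So the trajectories are locally ultimately bounded by $\mathcal B_{r_s}$. 2. The inter-event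 times are uniformly bounded below by a positive constant. More precisely, there are a constant $L_1>0$ with $\|(\dot y;\dot v)\|\le L_1\|(y;w;e)\|$ whenever the current and the sampled state lie in $S_1$, and a constant $\sigma_l>0$ with $\sigma_l\le\sigma(\|w\|+\|y\|^{p+1})$ on $S_v\setminus S_2$; and for all such $L_1,\sigma_l$, with $\delta=L_1\delta_{yw}$, every execution with $(y(t_0);w(t_0))\in S_v$ (even one defined only on a bounded time interval, at whose end event times might accumulate) satisfies $$t_{i+1}-t_i\ \ge\ \tau_3=\frac1{L_1}\ln\Bigl(1+\frac{\sigma_lL_1}{\delta}\Bigr)>0\qquad\text{for all }i\ge1\text{ for which } t_{i+1}\text{ exists}.$$ -/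

import Mathlib

open Set Filter Topology
open scoped Matrix

namespace EventTrig

/-- `ℝⁿ` with the Euclidean norm. -/
abbrev Vec (n : ℕ) : Type := EuclideanSpace ℝ (Fin n)

/-- The product `M x` of a matrix and a vector. -/
noncomputable def app {a b : ℕ} (M : Matrix (Fin a) (Fin b) ℝ) (x : Vec b) : Vec a :=
  Matrix.toEuclideanLin M x

/-- The Euclidean norm of the concatenation `(y;w)`. -/
noncomputable def pairNorm {a b : ℕ} (y : Vec a) (w : Vec b) : ℝ :=
  Real.sqrt (‖y‖ ^ 2 + ‖w‖ ^ 2)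

/-- Smallest eigenvalue (used for symmetric matrices of positive size). -/
noncomputable def lamMin {l : ℕ} (P : Matrix (Fin l) (Fin l) ℝ) : ℝ := sInf (spectrum ℝ P)

/-- Largest eigenvalue (used for symmetric matrices of positive size). -/
noncomputable def lamMax {l : ℕ} (P : Matrix (Fin l) (Fin l) ℝ) : ℝ := sSup (spectrum ℝ P)

open scoped Matrix.Norms.L2Operator in
/-- The matrix norm induced by the Euclidean norms. -/
noncomputable def opNorm {ι κ : Type} [Fintype ι] [DecidableEq ι] [Fintype κ] [DecidableEq κ]
    (M : Matrix ι κ ℝ) : ℝ := ‖M‖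

/-- `x` solves `ẋ = F x` on the interval `J` (one-sided derivatives at end points in `J`). -/
def IsSolOn {X : Type*} [NormedAddCommGroup X] [NormedSpace ℝ X] (F : X → X) (J : Set ℝ)
    (x : ℝ → X) : Prop :=
  ∀ t ∈ J, HasDerivWithinAt x (F (x t)) J t

/-- Local asymptotic stability of the origin for `ẏ = F y`, where `F` is considered on `D`. -/
structure LocallyAsympStable {X : Type*} [NormedAddCommGroup X] [NormedSpace ℝ X]
    (F : X → X) (D : Set X) : Prop where
  equilibrium : F 0 = 0
  stable : ∀ ε > 0, ∃ η > 0, ∀ (T : ℝ) (x : ℝ → X), IsSolOn F (Ico 0 T) x →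
    (∀ t ∈ Ico 0 T, x t ∈ D) → ‖x 0‖ < η → ∀ t ∈ Ico 0 T, ‖x t‖ < ε
  attractive : ∃ η > 0, ∀ x : ℝ → X, IsSolOn F (Ici 0) x →
    (∀ t ∈ Ici (0 : ℝ), x t ∈ D) → ‖x 0‖ < η → Tendsto x atTop (𝓝 0)

/-- The data of the control system
`ẏ = A₁ y + g₁(y,z,u)`, `ż = A₂ z + B₂ u + g₂(y,z,u)`,
of the feedback `u = K₁₁ z + K₁₂ y + Kₙ(y)` and of the change of variables `v = z - E y`. -/
structure Loop (k l m : ℕ) where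
  A₁ : Matrix (Fin k) (Fin k) ℝ
  A₂ : Matrix (Fin l) (Fin l) ℝ
  B₂ : Matrix (Fin l) (Fin m) ℝ
  g₁ : Vec k × Vec l × Vec m → Vec k
  g₂ : Vec k × Vec l × Vec m → Vec l
  K₁₁ : Matrix (Fin m) (Fin l) ℝ
  K₁₂ : Matrix (Fin m) (Fin k) ℝ
  Kₙ : Vec k → Vec m
  E : Matrix (Fin l) (Fin k) ℝ

namespace Loop

variable {k l m : ℕ} (c : Loop k l m)

/-- Right-hand side of the `y` equation. -/
noncomputable def fy (y : Vec k) (z : Vec l) (u : Vec m) : Vec k :=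
  app c.A₁ y + c.g₁ (y, z, u)

/-- Right-hand side of the `z` equation. -/
noncomputable def fz (y : Vec k) (z : Vec l) (u : Vec m) : Vec l :=
  app c.A₂ z + app c.B₂ u + c.g₂ (y, z, u)

/-- The feedback law `K(y;z)`. -/
noncomputable def ctrl (y : Vec k) (z : Vec l) : Vec m :=
  app c.K₁₁ z + app c.K₁₂ y + c.Kₙ y

/-- `A_K = A₂ + B₂ K₁₁`. -/
noncomputable def AK : Matrix (Fin l) (Fin l) ℝ := c.A₂ + c.B₂ * c.K₁₁

/-- `K₁ = [K₁₂ + K₁₁ E, K₁₁]`. -/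
noncomputable def K₁ : Matrix (Fin m) (Fin k ⊕ Fin l) ℝ :=
  Matrix.fromCols (c.K₁₂ + c.K₁₁ * c.E) c.K₁₁

/-- The nonlinearity of the `y` equation of the closed loop, in the variables `(y,v)`. -/
noncomputable def gc₁ (y : Vec k) (v : Vec l) : Vec k :=
  c.g₁ (y, v + app c.E y, c.ctrl y (v + app c.E y))

/-- The nonlinearity of the `v` equation of the closed loop, in the variables `(y,v)`. -/
noncomputable def gc₂ (y : Vec k) (v : Vec l) : Vec l :=
  app c.B₂ (c.Kₙ y) + c.g₂ (y, v + app c.E y, c.ctrl y (v + app c.E y))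
    - app c.E (c.g₁ (y, v + app c.E y, c.ctrl y (v + app c.E y)))

/-- The closed loop `ẏ = A₁ y + gc₁(y,v)`, `v̇ = A_K v + gc₂(y,v)` with continuous feedback. -/
noncomputable def closedLoop (q : Vec k × Vec l) : Vec k × Vec l :=
  (app c.A₁ q.1 + c.gc₁ q.1 q.2, app c.AK q.2 + c.gc₂ q.1 q.2)

/-- Standing assumptions on the system and the feedback, with the hypotheses of the center
manifold theorem for the closed loop. -/
structure Admissible : Prop where
  g₁_smooth : ContDiff ℝ 2 c.g₁
  g₂_smooth : ContDiff ℝ 2 c.g₂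
  g₁_zero : c.g₁ 0 = 0
  g₂_zero : c.g₂ 0 = 0
  g₁_deriv : fderiv ℝ c.g₁ 0 = 0
  g₂_deriv : fderiv ℝ c.g₂ 0 = 0
  Kₙ_smooth : ContDiff ℝ 1 c.Kₙ
  Kₙ_zero : c.Kₙ 0 = 0
  E_eq : c.AK * c.E - c.E * c.A₁ + c.B₂ * c.K₁₂ = 0
  gc₁_smooth : ContDiff ℝ 2 (fun q : Vec k × Vec l => c.gc₁ q.1 q.2)
  gc₂_smooth : ContDiff ℝ 2 (fun q : Vec k × Vec l => c.gc₂ q.1 q.2)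
  gc₁_deriv : fderiv ℝ (fun q : Vec k × Vec l => c.gc₁ q.1 q.2) 0 = 0
  gc₂_deriv : fderiv ℝ (fun q : Vec k × Vec l => c.gc₂ q.1 q.2) 0 = 0
  A₁_critical : ∀ μ ∈ spectrum ℂ (c.A₁.map (fun x : ℝ => (x : ℂ))), μ.re = 0
  AK_hurwitz : ∀ μ ∈ spectrum ℂ (c.AK.map (fun x : ℝ => (x : ℂ))), μ.re < 0

/-- `v = h(y)`, `‖y‖ < ρ`, is a (local) center manifold of the closed loop: `h` is `C¹`, tangent
to the `y`-space at the origin, and a solution that starts on the graph stays on it as long as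
its `y`-component stays in the domain of `h`. -/
structure IsCenterManifold (ρ : ℝ) (h : Vec k → Vec l) : Prop where
  radius_pos : 0 < ρ
  smooth : ContDiffOn ℝ 1 h (Metric.ball 0 ρ)
  zero : h 0 = 0
  tangent : fderiv ℝ h 0 = 0
  invariant : ∀ (T : ℝ) (x : ℝ → Vec k × Vec l), 0 < T →
    IsSolOn c.closedLoop (Ico 0 T) x → (∀ t ∈ Ico 0 T, (x t).1 ∈ Metric.ball 0 ρ) →
    (x 0).2 = h (x 0).1 → ∀ t ∈ Ico 0 T, (x t).2 = h (x t).1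

/-- Right-hand side of the reduced system `ẏ = A₁ y + gc₁(y,h(y))`. -/
noncomputable def reduced (h : Vec k → Vec l) (y : Vec k) : Vec k :=
  app c.A₁ y + c.gc₁ y (h y)

/-- The coordinate `v = z - E y`. -/
noncomputable def vco (y : Vec k) (z : Vec l) : Vec l := z - app c.E y

/-- The coordinate `w = v - h(y)`. -/
noncomputable def wco (h : Vec k → Vec l) (y : Vec k) (z : Vec l) : Vec l := c.vco y z - h y

end Loop

/-- `α₁(r) = min(1, √λ_min(P)) r`. -/
noncomputable def alpha₁ {l : ℕ} (P : Matrix (Fin l) (Fin l) ℝ) (r : ℝ) : ℝ :=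
  min 1 (Real.sqrt (lamMin P)) * r

/-- The inverse of `α₂(r) = √2 max(1, √λ_max(P)) r`. -/
noncomputable def alpha₂inv {l : ℕ} (P : Matrix (Fin l) (Fin l) ℝ) (r : ℝ) : ℝ :=
  r / (Real.sqrt 2 * max 1 (Real.sqrt (lamMax P)))

/-- The Lyapunov function `V(y,w) = ‖y‖ + √(wᵀ P w)`. -/
noncomputable def lyap {k l : ℕ} (P : Matrix (Fin l) (Fin l) ℝ) (y : Vec k) (w : Vec l) : ℝ :=
  ‖y‖ + Real.sqrt (inner ℝ w (app P w))

/-- The open Euclidean ball of radius `r` in the `(y;w)`-space. -/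
def pairBall (k l : ℕ) (r : ℝ) : Set (Vec k × Vec l) := {q | pairNorm q.1 q.2 < r}

/-- `S_v = {(y;w) : ‖(y;w)‖ < δ, V(y,w) ≤ α₁(δ)}`. -/
def Sv (k : ℕ) {l : ℕ} (P : Matrix (Fin l) (Fin l) ℝ) (δ : ℝ) : Set (Vec k × Vec l) :=
  {q | q ∈ pairBall k l δ ∧ lyap P q.1 q.2 ≤ alpha₁ P δ}

/-- `S₂ = {(y;w) : ‖(y;w)‖ < r₁}` with `r₁ = α₂⁻¹(α₁(r_s))`. -/
def S₂ (k : ℕ) {l : ℕ} (P : Matrix (Fin l) (Fin l) ℝ) (rs : ℝ) : Set (Vec k × Vec l) :=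
  pairBall k l (alpha₂inv P (alpha₁ P rs))

/-- The parameters of the implementation rule: the center manifold `h`, the matrix `P`, the
exponent `p`, the threshold `σ`, the radius `δ` that defines `S_v` and the radius `r_s` that
defines `S₂`. -/
structure Rule (k l : ℕ) where
  h : Vec k → Vec l
  P : Matrix (Fin l) (Fin l) ℝ
  p : ℝ
  sig : ℝ
  δ : ℝ
  rs : ℝ

namespace Rule

variable {k l m : ℕ} (R : Rule k l)

/-- The region `S_v \ S₂` in which events may occur. -/
def active : Set (Vec k × Vec l) := Sv k R.P R.δ \ S₂ k R.P R.rs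

/-- The threshold `σ(‖w‖ + ‖y‖^(p+1))`. -/
noncomputable def threshold (y : Vec k) (w : Vec l) : ℝ := R.sig * (‖w‖ + ‖y‖ ^ (R.p + 1))

end Rule

/-- `τ` is the least element of `A`, and `τ = ∞` when `A` is empty. -/
def IsFirst (A : Set ℝ) (τ : EReal) : Prop :=
  (∃ s : ℝ, τ = (s : EReal) ∧ IsLeast A s) ∨ (τ = ⊤ ∧ A = ∅)

/-- An execution on the time interval `[t₀, T)`, `T ≤ ∞`, of the event-triggered closed loop.
`t i` is the `i`-th event time for `i ≥ 1`, with `t i = ∞` if there is no `i`-th event before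
time `T`, and `t 0 = t₀`. An accumulation of event times is possible at `T`. -/
structure IsExecution {k l m : ℕ} (c : Loop k l m) (R : Rule k l) (t₀ : ℝ) (T : EReal)
    (y : ℝ → Vec k) (z : ℝ → Vec l) (u : ℝ → Vec m) (t : ℕ → EReal) : Prop where
  horizon : (t₀ : EReal) < T
  start : t 0 = t₀
  first_event : IsFirst
    {s : ℝ | t₀ ≤ s ∧ (s : EReal) < T ∧ (y s, c.wco R.h (y s) (z s)) ∈ R.active} (t 1)
  next_event : ∀ i : ℕ, 1 ≤ i → ∀ a : ℝ, t i = (a : EReal) → IsFirst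
    {s : ℝ | a ≤ s ∧ (s : EReal) < T ∧
      R.threshold (y s) (c.wco R.h (y s) (z s)) ≤
        pairNorm (y a - y s) (c.vco (y a) (z a) - c.vco (y s) (z s)) ∧
      (y s, c.wco R.h (y s) (z s)) ∈ R.active} (t (i + 1))
  no_event : ∀ i : ℕ, 1 ≤ i → t i = ⊤ → t (i + 1) = ⊤
  covered : ∀ s : ℝ, t₀ ≤ s → (s : EReal) < T → ∃ i : ℕ, (s : EReal) < t (i + 1)
  input_initial : ∀ s : ℝ, t₀ ≤ s → (s : EReal) < T → (s : EReal) < t 1 → u s = 0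
  input_held : ∀ i : ℕ, 1 ≤ i → ∀ a : ℝ, t i = (a : EReal) → ∀ s : ℝ, a ≤ s →
    (s : EReal) < T → (s : EReal) < t (i + 1) → u s = c.ctrl (y a) (z a)
  y_cont : ContinuousOn y {s : ℝ | t₀ ≤ s ∧ (s : EReal) < T}
  z_cont : ContinuousOn z {s : ℝ | t₀ ≤ s ∧ (s : EReal) < T}
  y_ode : ∀ s : ℝ, t₀ ≤ s → (s : EReal) < T →
    HasDerivWithinAt y (c.fy (y s) (z s) (u s)) (Ici s) s
  z_ode : ∀ s : ℝ, t₀ ≤ s → (s : EReal) < T →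
    HasDerivWithinAt z (c.fz (y s) (z s) (u s)) (Ici s) s

/-- `L` bounds the speed `‖(ẏ;v̇)‖` under sampled feedback by `L ‖(y;w;e)‖`, whenever the current
state `(y;w)` and the sampled state `(y';w')` have norm less than `δ`; here
`e = (y' - y; v' - v)` is the measurement error, `v = w + h(y)` and `v' = w' + h(y')`. -/
def IsGrowthConst {k l m : ℕ} (c : Loop k l m) (h : Vec k → Vec l) (δ L : ℝ) : Prop :=
  ∀ (y y' : Vec k) (w w' : Vec l), (y, w) ∈ pairBall k l δ → (y', w') ∈ pairBall k l δ →
    let z := w + h y + app c.E y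
    let u := c.ctrl y' (w' + h y' + app c.E y')
    pairNorm (c.fy y z u) (c.fz y z u - app c.E (c.fy y z u)) ≤
      L * Real.sqrt (‖y‖ ^ 2 + ‖w‖ ^ 2 + ‖y' - y‖ ^ 2 + ‖(w' + h y') - (w + h y)‖ ^ 2)

/-- `s` is a lower bound of the threshold on the region where events may occur. -/
def IsThresholdBound {k l : ℕ} (R : Rule k l) (s : ℝ) : Prop :=
  ∀ q ∈ R.active, s ≤ R.threshold q.1 q.2

/-- `τ₃ = (1/L₁) ln(1 + σ_l L₁ / δ')` with `δ' = L₁ δ`. -/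
noncomputable def tau₃ (L s δ : ℝ) : ℝ := 1 / L * Real.log (1 + s * L / (L * δ))

end EventTrig

open EventTrig

/-!
In the coordinates `(y, w)`, `w = v - h(y)`, the sampled loop is, near the origin, the reduced
system in `y` together with the linear system `ẇ = A_K w + B₂ K₁ e` in `w`, up to an arbitrarily
small multiple of `‖w‖ + ‖e‖` (`Loop.exists_radius_perturbation`). The reasons are that all
nonlinearities are strictly differentiable at the origin with derivative zero, including `B₂ Kₙ`
(although `Kₙ` may have a linear part), and that the invariance of the graph of `h` gives
`Dh(y) gc₁(y, h(y)) = A_K h(y) + gc₂(y, h(y))` (`Loop.IsCenterManifold.fderiv_apply`).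

The Lyapunov function `V = ‖y‖ + √(wᵀ P w)` is not differentiable where `y = 0` or `w = 0`, but it
has a right derivative along every curve that has one. While the error obeys `‖e‖ ≤ σ(‖w‖ +
‖y‖^(p+1))`, the bound on `σ` leaves the part `s_f` of the decay of `√(wᵀ P w)`, and the terms in
`‖y‖^(p+1)` are absorbed by the decay `-k₆ ‖y‖^p` of `‖y‖`; so the right derivative of `V` is at
most `-a (‖y‖^p + ‖w‖)` (`exists_radius_decay`), which is bounded away from zero on `S_v \ S₂`.

An event occurs as soon as this decay might fail in `S_v \ S₂`. Consequently `S_v` is forward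
invariant (`DissipatesOn.mem_Sv`; it is not closed, and it is the strict decrease of `V` that keeps
curves from leaving through the missing boundary), `S₂` is visited within a uniform time, and
after that `V ≤ α₁(r_s)` keeps the state in the ball of radius `r_s`
(`DissipatesOn.mem_pairBall_of_mem_S₂`). Inside `S_v`, Grönwall's inequality bounds the time that
the error needs to grow from zero to the threshold (`tau₃_le_of_held`).

Executions are glued from solutions under constant inputs (`exists_isExecution`). Each stage is a
global solution of a cut-off vector field, it stays in `S_v` up to its next event, and the event
time is attained as a minimum because the conditions that define it are closed in `S_v`. The lower
bound on the inter-event times excludes accumulation.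
-/

namespace EventTrig

/-! ### The right derivative of the norm of a curve -/

/-- The norm of a curve has a right derivative wherever the curve has one, also at a zero of the
curve, where the norm itself is not differentiable. -/
theorem exists_hasDerivWithinAt_norm_Ici {X : Type*} [NormedAddCommGroup X]
    [InnerProductSpace ℝ X] {x : ℝ → X} {x' : X} {s : ℝ}
    (hx : HasDerivWithinAt x x' (Ici s) s) :
    ∃ d, HasDerivWithinAt (fun t => ‖x t‖) d (Ici s) s ∧
      d * ‖x s‖ = inner ℝ (x s) x' ∧ (x s = 0 → d = ‖x'‖) := by
  by_cases h0 : x s = 0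
  · refine ⟨‖x'‖, ?_, by simp [h0], fun _ => rfl⟩
    rw [← hasDerivWithinAt_Ioi_iff_Ici, hasDerivWithinAt_iff_tendsto_slope' self_notMem_Ioi] at hx ⊢
    refine hx.norm.congr' ?_
    filter_upwards [self_mem_nhdsWithin] with t ht
    have ht' : 0 < t - s := sub_pos.2 ht
    simp [slope_def_module, h0, norm_smul, abs_of_pos ht']
  · refine ⟨_, ((hx.norm_sq).sqrt (by simpa using h0)).congr (fun t _ => ?_) ?_, ?_,
      fun h => absurd h h0⟩
    · rw [Real.sqrt_sq (norm_nonneg _)]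
    · rw [Real.sqrt_sq (norm_nonneg _)]
    · have : ‖x s‖ ≠ 0 := by simpa using h0
      rw [Real.sqrt_sq (norm_nonneg _)]
      field_simp

/-! ### Matrices as linear maps -/

section Matrix

variable {a b d : ℕ}

theorem app_add (M : Matrix (Fin a) (Fin b) ℝ) (x y : Vec b) : app M (x + y) = app M x + app M y :=
  map_add _ _ _

theorem app_sub (M : Matrix (Fin a) (Fin b) ℝ) (x y : Vec b) : app M (x - y) = app M x - app M y :=
  map_sub _ _ _

theorem app_zero (M : Matrix (Fin a) (Fin b) ℝ) : app M 0 = 0 := map_zero _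

theorem add_app (M N : Matrix (Fin a) (Fin b) ℝ) (x : Vec b) : app (M + N) x = app M x + app N x := by
  simp [app]

theorem neg_app (M : Matrix (Fin a) (Fin b) ℝ) (x : Vec b) : app (-M) x = -app M x := by
  simp [app]

theorem zero_app (x : Vec b) : app (0 : Matrix (Fin a) (Fin b) ℝ) x = 0 := by
  simp [app]

theorem mul_app (M : Matrix (Fin a) (Fin b) ℝ) (N : Matrix (Fin b) (Fin d) ℝ) (x : Vec d) :
    app (M * N) x = app M (app N x) := by
  simp [app, Matrix.toLpLin_apply]

/-- The continuous linear map of a matrix. -/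
noncomputable def appL (M : Matrix (Fin a) (Fin b) ℝ) : Vec b →L[ℝ] Vec a :=
  LinearMap.toContinuousLinearMap (Matrix.toEuclideanLin M)

theorem appL_apply (M : Matrix (Fin a) (Fin b) ℝ) (x : Vec b) : appL M x = app M x := rfl

theorem norm_app_le (M : Matrix (Fin a) (Fin b) ℝ) (x : Vec b) : ‖app M x‖ ≤ ‖appL M‖ * ‖x‖ :=
  (appL M).le_opNorm x

theorem inner_app_transpose (M : Matrix (Fin a) (Fin b) ℝ) (x : Vec a) (y : Vec b) :
    inner ℝ (app Mᵀ x) y = inner ℝ x (app M y) := by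
  simp only [app, Matrix.toLpLin_apply, PiLp.inner_apply, RCLike.inner_apply, conj_trivial]
  change y.ofLp ⬝ᵥ (Mᵀ *ᵥ x.ofLp) = (M *ᵥ y.ofLp) ⬝ᵥ x.ofLp
  rw [Matrix.mulVec_transpose, dotProduct_comm, ← Matrix.dotProduct_mulVec, dotProduct_comm]

end Matrix

/-! ### Spectral bounds and the comparison functions -/

section Spectral

variable {l : ℕ} {P : Matrix (Fin l) (Fin l) ℝ}

/-- The quadratic form of a symmetric matrix in an orthonormal basis of eigenvectors. -/
theorem inner_app_eq_sum (hP : P.IsHermitian) (w : Vec l) :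
    inner ℝ w (app P w) = ∑ i, hP.eigenvalues i * (inner ℝ (hP.eigenvectorBasis i) w) ^ 2 := by
  rw [← OrthonormalBasis.sum_inner_mul_inner hP.eigenvectorBasis w (app P w)]
  refine Finset.sum_congr rfl fun i _ => ?_
  have h1 : app P (hP.eigenvectorBasis i) = hP.eigenvalues i • hP.eigenvectorBasis i := by
    have := hP.mulVec_eigenvectorBasis i
    apply (WithLp.ofLp_injective 2)
    simpa [app, Matrix.toLpLin_apply] using this
  have h2 : inner ℝ (hP.eigenvectorBasis i) (app P w)
      = hP.eigenvalues i * inner ℝ (hP.eigenvectorBasis i) w := by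
    have : Pᵀ = P := by simpa using hP.eq
    rw [← inner_app_transpose, this, h1, real_inner_smul_left]
  rw [h2, real_inner_comm]
  ring

theorem lamMin_mul_le_inner (hP : P.IsHermitian) (w : Vec l) :
    lamMin P * ‖w‖ ^ 2 ≤ inner ℝ w (app P w) := by
  rw [inner_app_eq_sum hP, ← hP.eigenvectorBasis.sum_sq_inner_right w, Finset.mul_sum]
  refine Finset.sum_le_sum fun i _ => ?_
  refine mul_le_mul_of_nonneg_right ?_ (sq_nonneg _)
  exact csInf_le (Matrix.finite_real_spectrum).bddBelow (hP.eigenvalues_mem_spectrum_real i)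

theorem inner_le_lamMax_mul (hP : P.IsHermitian) (w : Vec l) :
    inner ℝ w (app P w) ≤ lamMax P * ‖w‖ ^ 2 := by
  rw [inner_app_eq_sum hP, ← hP.eigenvectorBasis.sum_sq_inner_right w, Finset.mul_sum]
  refine Finset.sum_le_sum fun i _ => ?_
  refine mul_le_mul_of_nonneg_right ?_ (sq_nonneg _)
  exact le_csSup (Matrix.finite_real_spectrum).bddAbove (hP.eigenvalues_mem_spectrum_real i)

theorem lamMin_pos (hl : 0 < l) (hP : P.PosDef) : 0 < lamMin P := by
  have : Nonempty (Fin l) := ⟨⟨0, hl⟩⟩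
  have hne : (spectrum ℝ P).Nonempty := ⟨_, hP.1.eigenvalues_mem_spectrum_real ⟨0, hl⟩⟩
  have hmem : lamMin P ∈ spectrum ℝ P := hne.csInf_mem Matrix.finite_real_spectrum
  rw [hP.1.spectrum_real_eq_range_eigenvalues] at hmem
  obtain ⟨i, hi⟩ := hmem
  rw [← hi]
  exact hP.eigenvalues_pos i

theorem lamMin_le_lamMax (hl : 0 < l) (hP : P.PosDef) : lamMin P ≤ lamMax P := by
  have h1 := hP.1.eigenvalues_mem_spectrum_real ⟨0, hl⟩
  exact (csInf_le (Matrix.finite_real_spectrum).bddBelow h1).trans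
    (le_csSup (Matrix.finite_real_spectrum).bddAbove h1)

end Spectral

section PairNorm

variable {a b : ℕ} (y : Vec a) (w : Vec b)

theorem pairNorm_eq : pairNorm y w = ‖WithLp.toLp 2 (y, w)‖ := by
  rw [WithLp.prod_norm_eq_of_L2]; rfl

theorem pairNorm_nonneg : 0 ≤ pairNorm y w := Real.sqrt_nonneg _

theorem pairNorm_sq : pairNorm y w ^ 2 = ‖y‖ ^ 2 + ‖w‖ ^ 2 := Real.sq_sqrt (by positivity)

theorem norm_fst_le_pairNorm : ‖y‖ ≤ pairNorm y w :=
  Real.le_sqrt_of_sq_le (by nlinarith [sq_nonneg ‖w‖])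

theorem norm_snd_le_pairNorm : ‖w‖ ≤ pairNorm y w :=
  Real.le_sqrt_of_sq_le (by nlinarith [sq_nonneg ‖y‖])

theorem pairNorm_le_add : pairNorm y w ≤ ‖y‖ + ‖w‖ :=
  Real.sqrt_le_iff.2 ⟨by positivity, by nlinarith [norm_nonneg y, norm_nonneg w]⟩

theorem add_le_sqrt_two_mul_pairNorm : ‖y‖ + ‖w‖ ≤ √2 * pairNorm y w := by
  unfold pairNorm
  rw [← Real.sqrt_mul (by norm_num)]
  exact Real.le_sqrt_of_sq_le (by nlinarith [sq_nonneg (‖y‖ - ‖w‖)])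

theorem continuous_pairNorm : Continuous fun q : Vec a × Vec b => pairNorm q.1 q.2 := by
  unfold pairNorm; fun_prop

end PairNorm

section Lyapunov

variable {k l : ℕ} {P : Matrix (Fin l) (Fin l) ℝ}

/-- `√(wᵀ P w)`, the norm of `w` weighted by `P`. -/
noncomputable def wnorm (P : Matrix (Fin l) (Fin l) ℝ) (w : Vec l) : ℝ :=
  √(inner ℝ w (app P w))

theorem lyap_eq (y : Vec k) (w : Vec l) : lyap P y w = ‖y‖ + wnorm P w := rfl

theorem continuous_app {a b : ℕ} (M : Matrix (Fin a) (Fin b) ℝ) : Continuous (app M) :=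
  (appL M).continuous

theorem continuous_lyap : Continuous fun q : Vec k × Vec l => lyap P q.1 q.2 := by
  have := continuous_app P
  unfold lyap; fun_prop

theorem sqrt_lamMin_mul_le_wnorm (hl : 0 < l) (hP : P.PosDef) (w : Vec l) :
    √(lamMin P) * ‖w‖ ≤ wnorm P w := by
  refine Real.le_sqrt_of_sq_le ?_
  rw [mul_pow, Real.sq_sqrt (lamMin_pos hl hP).le]
  exact lamMin_mul_le_inner hP.1 w

theorem wnorm_le_sqrt_lamMax_mul (hl : 0 < l) (hP : P.PosDef) (w : Vec l) :
    wnorm P w ≤ √(lamMax P) * ‖w‖ := by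
  refine Real.sqrt_le_iff.2 ⟨by positivity, ?_⟩
  rw [mul_pow, Real.sq_sqrt ((lamMin_pos hl hP).le.trans (lamMin_le_lamMax hl hP))]
  exact inner_le_lamMax_mul hP.1 w

theorem lyap_nonneg (y : Vec k) (w : Vec l) : 0 ≤ lyap P y w :=
  add_nonneg (norm_nonneg _) (Real.sqrt_nonneg _)

theorem alpha₁_coeff_pos (hl : 0 < l) (hP : P.PosDef) : 0 < min 1 √(lamMin P) :=
  lt_min one_pos (Real.sqrt_pos.2 (lamMin_pos hl hP))

/-- The lower comparison function: `α₁(‖(y;w)‖) ≤ V(y,w)`. -/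
theorem alpha₁_le_lyap (hl : 0 < l) (hP : P.PosDef) (y : Vec k) (w : Vec l) :
    alpha₁ P (pairNorm y w) ≤ lyap P y w := by
  have h0 := alpha₁_coeff_pos hl hP
  calc alpha₁ P (pairNorm y w) ≤ min 1 √(lamMin P) * (‖y‖ + ‖w‖) :=
        mul_le_mul_of_nonneg_left (pairNorm_le_add y w) h0.le
    _ = min 1 √(lamMin P) * ‖y‖ + min 1 √(lamMin P) * ‖w‖ := mul_add _ _ _
    _ ≤ 1 * ‖y‖ + √(lamMin P) * ‖w‖ := by
        gcongr
        · exact min_le_left _ _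
        · exact min_le_right _ _
    _ ≤ lyap P y w := by
        rw [one_mul, lyap_eq]
        gcongr
        exact sqrt_lamMin_mul_le_wnorm hl hP w

theorem alpha₂_coeff_pos (P : Matrix (Fin l) (Fin l) ℝ) : 0 < √2 * max 1 √(lamMax P) := by
  positivity

/-- The upper comparison function: `V(y,w) ≤ α₂(‖(y;w)‖)`. -/
theorem lyap_le_alpha₂ (hl : 0 < l) (hP : P.PosDef) (y : Vec k) (w : Vec l) :
    lyap P y w ≤ √2 * max 1 √(lamMax P) * pairNorm y w := by
  calc lyap P y w ≤ 1 * ‖y‖ + √(lamMax P) * ‖w‖ := by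
        rw [one_mul, lyap_eq]
        gcongr
        exact wnorm_le_sqrt_lamMax_mul hl hP w
    _ ≤ max 1 √(lamMax P) * ‖y‖ + max 1 √(lamMax P) * ‖w‖ := by
        gcongr
        · exact le_max_left _ _
        · exact le_max_right _ _
    _ = max 1 √(lamMax P) * (‖y‖ + ‖w‖) := (mul_add _ _ _).symm
    _ ≤ max 1 √(lamMax P) * (√2 * pairNorm y w) := by
        gcongr
        exact add_le_sqrt_two_mul_pairNorm y w
    _ = _ := by ring

open scoped MatrixOrder in
/-- The analogue for the weighted norm, which is the Euclidean norm of `B w` if `P = Bᵀ B`. -/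
theorem exists_hasDerivWithinAt_wnorm (hP : P.PosDef) {w : ℝ → Vec l} {w' : Vec l}
    {s : ℝ} (hw : HasDerivWithinAt w w' (Ici s) s) :
    ∃ d, HasDerivWithinAt (fun t => wnorm P (w t)) d (Ici s) s ∧
      d * wnorm P (w s) = inner ℝ (w s) (app P w') ∧ (w s = 0 → d = wnorm P w') := by
  obtain ⟨B, hB⟩ := CStarAlgebra.nonneg_iff_eq_star_mul_self.1 hP.posSemidef.nonneg
  have hB' : P = Bᵀ * B := by simpa [Matrix.star_eq_conjTranspose] using hB
  have hin : ∀ x x' : Vec l, inner ℝ x (app P x') = inner ℝ (app B x) (app B x') := by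
    intro x x'
    rw [hB', mul_app, ← inner_app_transpose, Matrix.transpose_transpose]
  have hn : ∀ x : Vec l, wnorm P x = ‖app B x‖ := by
    intro x
    rw [wnorm, hin, real_inner_self_eq_norm_sq, Real.sqrt_sq (norm_nonneg _)]
  obtain ⟨d, h1, h2, h3⟩ := exists_hasDerivWithinAt_norm_Ici
    ((appL B).hasFDerivAt.comp_hasDerivWithinAt s hw)
  simp only [Function.comp_apply, appL_apply] at h1 h2 h3
  refine ⟨d, by simpa only [hn] using h1, by rw [hn, hin, h2], fun h => ?_⟩
  rw [hn, h3 (by rw [h, app_zero])]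

end Lyapunov

/-! ### Global curves of cut-off vector fields -/

/-- A bounded, globally Lipschitz autonomous vector field has global solutions: Picard–Lindelöf
applies on every interval `[-(n + 1), n + 1]`, and the solutions agree by uniqueness. -/
theorem exists_solution_of_lipschitz_of_bounded {X : Type*} [NormedAddCommGroup X]
    [NormedSpace ℝ X] [CompleteSpace X] {F : X → X} {K : NNReal} (hK : LipschitzWith K F)
    {C : ℝ} (hC : ∀ x, ‖F x‖ ≤ C) (x₀ : X) :
    ∃ φ : ℝ → X, φ 0 = x₀ ∧ ∀ t, HasDerivAt φ (F (φ t)) t := by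
  have hC0 : 0 ≤ C := (norm_nonneg _).trans (hC x₀)
  have hex : ∀ n : ℕ, ∃ α : ℝ → X, α 0 = x₀ ∧
      ∀ t ∈ Ioo (-((n : ℝ) + 1)) ((n : ℝ) + 1), HasDerivAt α (F (α t)) t := by
    intro n
    have hpl : IsPicardLindelof (fun _ => F) (tmin := -((n : ℝ) + 1)) (tmax := (n : ℝ) + 1)
        ⟨0, by constructor <;> linarith [n.cast_nonneg (α := ℝ)]⟩ x₀
        (⟨C, hC0⟩ * (n + 1)) 0 ⟨C, hC0⟩ K := by
      refine IsPicardLindelof.of_time_independent (fun x _ => hC x) (hK.lipschitzOnWith) ?_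
      simp only [sub_zero, zero_sub, neg_neg, max_self, NNReal.coe_zero]
      exact le_rfl
    obtain ⟨α, h0, hα⟩ := hpl.exists_eq_forall_mem_Icc_hasDerivWithinAt₀
    exact ⟨α, h0, fun t ht => (hα t (Ioo_subset_Icc_self ht)).hasDerivAt (Icc_mem_nhds ht.1 ht.2)⟩
  choose α h0 hα using hex
  have huniq : ∀ n m : ℕ, n ≤ m → EqOn (α n) (α m) (Ioo (-((n : ℝ) + 1)) ((n : ℝ) + 1)) := by
    intro n m hnm
    have hnm' : (n : ℝ) ≤ m := by exact_mod_cast hnm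
    refine ODE_solution_unique_of_mem_Ioo (v := fun _ => F) (s := fun _ => univ) (K := K) (t₀ := 0)
      (fun t _ => hK.lipschitzOnWith)
      (by constructor <;> linarith [n.cast_nonneg (α := ℝ)]) (fun t ht => ⟨hα n t ht, mem_univ _⟩)
      (fun t ht => ⟨hα m t ⟨by linarith [ht.1], by linarith [ht.2]⟩, mem_univ _⟩)
      (by rw [h0, h0])
  refine ⟨fun t => α ⌈|t|⌉₊ t, by simp [h0], fun t => ?_⟩
  have hceil : |t| ≤ ⌈|t|⌉₊ := Nat.le_ceil _
  have ht : t ∈ Ioo (-((⌈|t|⌉₊ : ℝ) + 1)) ((⌈|t|⌉₊ : ℝ) + 1) :=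
    abs_lt.1 (by linarith)
  refine (hα ⌈|t|⌉₊ t ht).congr_of_eventuallyEq ?_
  filter_upwards [Ioo_mem_nhds ht.1 ht.2] with s hs
  have hs' : |s| ≤ ⌈|s|⌉₊ := Nat.le_ceil _
  rcases le_total ⌈|s|⌉₊ ⌈|t|⌉₊ with h | h
  · exact huniq _ _ h (abs_lt.1 (by linarith))
  · exact (huniq _ _ h hs).symm

/-- For a `C¹` vector field, solutions cut off outside a ball: the curve is defined for all times
and solves the equation as long as it stays in the ball of radius `r`. -/
theorem exists_global_curve {X : Type*} [NormedAddCommGroup X]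
    [NormedSpace ℝ X] [FiniteDimensional ℝ X] {F : X → X} (hF : ContDiff ℝ 1 F) (r : ℝ) (x₀ : X) :
    ∃ φ : ℝ → X, φ 0 = x₀ ∧ Continuous φ ∧
      ∀ t, ‖φ t‖ < r → HasDerivAt φ (F (φ t)) t := by
  have : CompleteSpace X := FiniteDimensional.complete ℝ X
  -- `F` is multiplied by a bump function that is `1` on the ball of radius `r`
  let χ : ContDiffBump (0 : X) := ⟨max r 1, max r 1 + 1, by positivity, by linarith⟩
  have hG : ContDiff ℝ 1 (fun x => χ x • F x) := χ.contDiff.smul hF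
  have hsupp : HasCompactSupport (fun x => χ x • F x) := χ.hasCompactSupport.smul_right
  obtain ⟨K, hK⟩ := hG.lipschitzWith_of_hasCompactSupport hsupp one_ne_zero
  obtain ⟨C, hC⟩ := hsupp.exists_bound_of_continuous hG.continuous
  obtain ⟨φ, h0, hφ⟩ := exists_solution_of_lipschitz_of_bounded hK hC x₀
  refine ⟨φ, h0, continuous_iff_continuousAt.2 fun t => (hφ t).continuousAt, fun t ht => ?_⟩
  have h1 : χ (φ t) = 1 := χ.one_of_mem_closedBall (by
    rw [mem_closedBall_zero_iff]; exact ht.le.trans (le_max_left r 1))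
  simpa [h1] using hφ t

/-! ### Local estimates for the sampled loop -/

section Strict

variable {X Y : Type*} [NormedAddCommGroup X] [NormedSpace ℝ X] [NormedAddCommGroup Y]
  [NormedSpace ℝ Y]

/-- A map whose strict derivative at `0` vanishes is Lipschitz near `0` with arbitrarily small
constant. -/
theorem exists_lipschitz_of_strict_zero {f : X → Y}
    (hf : HasStrictFDerivAt f (0 : X →L[ℝ] Y) 0) {ε : ℝ} (hε : 0 < ε) :
    ∃ r > 0, ∀ x x', ‖x‖ < r → ‖x'‖ < r → ‖f x - f x'‖ ≤ ε * ‖x - x'‖ := by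
  have h1 := hf.isLittleO.bound hε
  rw [Metric.eventually_nhds_iff] at h1
  obtain ⟨r, hr, h⟩ := h1
  refine ⟨r, hr, fun x x' hx hx' => ?_⟩
  have := @h (x, x') (by simpa [Prod.dist_eq] using ⟨hx, hx'⟩)
  simpa using this

theorem exists_lipschitz_of_strict {f : X → Y} {f' : X →L[ℝ] Y}
    (hf : HasStrictFDerivAt f f' 0) :
    ∃ C > 0, ∃ r > 0, ∀ x x', ‖x‖ < r → ‖x'‖ < r → ‖f x - f x'‖ ≤ C * ‖x - x'‖ := by
  obtain ⟨C, hC, h1⟩ := hf.isBigO_sub.exists_pos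
  have h1 := h1.bound
  rw [Metric.eventually_nhds_iff] at h1
  obtain ⟨r, hr, h⟩ := h1
  refine ⟨C, hC, r, hr, fun x x' hx hx' => ?_⟩
  exact @h (x, x') (by simpa [Prod.dist_eq] using ⟨hx, hx'⟩)

end Strict

namespace Loop

variable {k l m : ℕ} {c : Loop k l m}

theorem ctrl_zero (hc : c.Admissible) : c.ctrl 0 0 = 0 := by
  simp [ctrl, app_zero, hc.Kₙ_zero]

theorem g₁_strict (hc : c.Admissible) :
    HasStrictFDerivAt c.g₁ (0 : Vec k × Vec l × Vec m →L[ℝ] Vec k) 0 := by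
  have := (hc.g₁_smooth.contDiffAt (x := 0)).hasStrictFDerivAt two_ne_zero
  rwa [hc.g₁_deriv] at this

theorem g₂_strict (hc : c.Admissible) :
    HasStrictFDerivAt c.g₂ (0 : Vec k × Vec l × Vec m →L[ℝ] Vec l) 0 := by
  have := (hc.g₂_smooth.contDiffAt (x := 0)).hasStrictFDerivAt two_ne_zero
  rwa [hc.g₂_deriv] at this

theorem gc₁_strict (hc : c.Admissible) : HasStrictFDerivAt
    (fun q : Vec k × Vec l => c.gc₁ q.1 q.2) (0 : Vec k × Vec l →L[ℝ] Vec k) 0 := by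
  have := (hc.gc₁_smooth.contDiffAt (x := 0)).hasStrictFDerivAt two_ne_zero
  rwa [hc.gc₁_deriv] at this

theorem gc₂_strict (hc : c.Admissible) : HasStrictFDerivAt
    (fun q : Vec k × Vec l => c.gc₂ q.1 q.2) (0 : Vec k × Vec l →L[ℝ] Vec l) 0 := by
  have := (hc.gc₂_smooth.contDiffAt (x := 0)).hasStrictFDerivAt two_ne_zero
  rwa [hc.gc₂_deriv] at this

theorem Kₙ_strict (hc : c.Admissible) : HasStrictFDerivAt c.Kₙ (fderiv ℝ c.Kₙ 0) 0 :=
  (hc.Kₙ_smooth.contDiffAt (x := 0)).hasStrictFDerivAt one_ne_zero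

/-- Since the closed loop and the plant both have nonlinearities of second order, so has
`B₂ Kₙ`, although `Kₙ` itself may have a linear part. -/
theorem B₂_Kₙ_strict (hc : c.Admissible) :
    HasStrictFDerivAt (fun y => app c.B₂ (c.Kₙ y)) (0 : Vec k →L[ℝ] Vec l) 0 := by
  have hE : HasStrictFDerivAt (fun y : Vec k => app c.E y) (appL c.E) 0 :=
    (appL c.E).hasStrictFDerivAt
  have hctrl : HasStrictFDerivAt (fun y : Vec k => c.ctrl y (app c.E y))
      ((appL c.K₁₁).comp (appL c.E) + appL c.K₁₂ + fderiv ℝ c.Kₙ 0) 0 :=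
    (((appL c.K₁₁).hasStrictFDerivAt.comp 0 hE).add (appL c.K₁₂).hasStrictFDerivAt).add
      (Kₙ_strict hc)
  have harg := (hasStrictFDerivAt_id (𝕜 := ℝ) (0 : Vec k)).prodMk (hE.prodMk hctrl)
  have h0 : ((id 0, app c.E 0, c.ctrl 0 (app c.E 0)) : Vec k × Vec l × Vec m) = 0 := by
    simp [app_zero, ctrl_zero hc]
  have h1 := HasStrictFDerivAt.comp (g := c.g₁) (0 : Vec k) (by rw [h0]; exact g₁_strict hc) harg
  have h2 := HasStrictFDerivAt.comp (g := c.g₂) (0 : Vec k) (by rw [h0]; exact g₂_strict hc) harg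
  have hE1 := (appL c.E).hasStrictFDerivAt.comp (0 : Vec k) h1
  have h3 := HasStrictFDerivAt.comp (g := fun q : Vec k × Vec l => c.gc₂ q.1 q.2) (0 : Vec k)
    (gc₂_strict hc)
    ((hasStrictFDerivAt_id (𝕜 := ℝ) (0 : Vec k)).prodMk (hasStrictFDerivAt_const (0 : Vec l) 0))
  have h4 := (h3.sub h2).add hE1
  -- the definition of `gc₂` at `v = 0`, solved for `B₂ Kₙ`
  have h5 : (fun y => app c.B₂ (c.Kₙ y)) = fun y : Vec k =>
      c.gc₂ y 0 - c.g₂ (y, app c.E y, c.ctrl y (app c.E y))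
        + app c.E (c.g₁ (y, app c.E y, c.ctrl y (app c.E y))) := by
    funext y
    simp only [gc₂, zero_add]
    abel
  rw [h5]
  refine h4.congr_fderiv ?_
  simp

theorem ctrl_sub (y y' : Vec k) (z z' : Vec l) :
    c.ctrl y' z' - c.ctrl y z
      = app c.K₁₁ (z' - z) + app c.K₁₂ (y' - y) + (c.Kₙ y' - c.Kₙ y) := by
  simp only [ctrl, app_sub]; abel

theorem exists_ctrl_lipschitz (hc : c.Admissible) :
    ∃ M > 0, ∃ r > 0, ∀ (y y' : Vec k) (z z' : Vec l), ‖y‖ < r → ‖y'‖ < r →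
      ‖c.ctrl y' z' - c.ctrl y z‖ ≤ M * (‖y' - y‖ + ‖z' - z‖) := by
  obtain ⟨C, hC, r, hr, h⟩ := exists_lipschitz_of_strict (Kₙ_strict hc)
  refine ⟨‖appL c.K₁₁‖ + ‖appL c.K₁₂‖ + C, by positivity, r, hr, fun y y' z z' hy hy' => ?_⟩
  rw [ctrl_sub]
  have h1 := norm_app_le c.K₁₁ (z' - z)
  have h2 := norm_app_le c.K₁₂ (y' - y)
  have h3 := h y' y hy' hy
  refine (norm_add₃_le).trans ?_
  have := norm_nonneg (appL c.K₁₁)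
  have := norm_nonneg (appL c.K₁₂)
  nlinarith [norm_nonneg (y' - y), norm_nonneg (z' - z),
    mul_nonneg (norm_nonneg (appL c.K₁₁)) (norm_nonneg (y' - y)),
    mul_nonneg (norm_nonneg (appL c.K₁₂)) (norm_nonneg (z' - z)),
    mul_nonneg hC.le (norm_nonneg (z' - z))]

theorem contDiff_closedLoop (hc : c.Admissible) : ContDiff ℝ 1 c.closedLoop := by
  have h1 : ContDiff ℝ 1 (fun q : Vec k × Vec l => c.gc₁ q.1 q.2) :=
    hc.gc₁_smooth.of_le one_le_two
  have h2 : ContDiff ℝ 1 (fun q : Vec k × Vec l => c.gc₂ q.1 q.2) :=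
    hc.gc₂_smooth.of_le one_le_two
  exact (((appL c.A₁).contDiff.comp contDiff_fst).add h1).prodMk
    (((appL c.AK).contDiff.comp contDiff_snd).add h2)

variable {ρ : ℝ} {h : Vec k → Vec l}

theorem IsCenterManifold.contDiffAt (hh : c.IsCenterManifold ρ h) {y : Vec k} (hy : ‖y‖ < ρ) :
    ContDiffAt ℝ 1 h y :=
  hh.smooth.contDiffAt (Metric.isOpen_ball.mem_nhds (by simpa using hy))

theorem IsCenterManifold.differentiableAt (hh : c.IsCenterManifold ρ h) {y : Vec k}
    (hy : ‖y‖ < ρ) : DifferentiableAt ℝ h y :=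
  (hh.contDiffAt hy).differentiableAt one_ne_zero

/-- The invariance of the graph of `h` in differential form: `Dh(y) ẏ = v̇` on the graph. -/
theorem IsCenterManifold.fderiv_apply (hc : c.Admissible) (hh : c.IsCenterManifold ρ h)
    (hA₁ : c.A₁ = 0) {y : Vec k} (hy : ‖y‖ < ρ) :
    fderiv ℝ h y (c.gc₁ y (h y)) = app c.AK (h y) + c.gc₂ y (h y) := by
  obtain ⟨x, hx0, ε, hε, hx⟩ := ((contDiff_closedLoop hc).contDiffAt
    (x := (y, h y))).exists_forall_mem_closedBall_exists_eq_forall_mem_Ioo_hasDerivAt₀ 0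
  have hx0' : HasDerivAt x (c.closedLoop (y, h y)) 0 := by
    have := hx 0 (by constructor <;> linarith)
    rwa [hx0] at this
  have hev : ∀ᶠ t in 𝓝 (0 : ℝ), ‖(x t).1‖ < ρ := by
    have : ContinuousAt (fun t => ‖(x t).1‖) 0 := hx0'.continuousAt.fst.norm
    exact this.eventually_lt continuousAt_const (by simpa [hx0] using hy)
  obtain ⟨η, hη, hη'⟩ := Metric.eventually_nhds_iff.1 hev
  set T := min ε η with hT
  have hT0 : 0 < T := lt_min hε hη
  have hinv := hh.invariant T x hT0
    (fun t ht => (hx t ⟨by linarith [ht.1], by linarith [ht.2, min_le_left ε η]⟩).hasDerivWithinAt)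
    (fun t ht => by
      simpa using hη' (y := t) (by
        rw [Real.dist_eq, sub_zero, abs_of_nonneg ht.1]; linarith [ht.2, min_le_right ε η]))
    (by rw [hx0])
  have hfst : HasDerivAt (fun t => (x t).1) (c.closedLoop (y, h y)).1 0 := hx0'.fst
  have hsnd : HasDerivAt (fun t => (x t).2) (c.closedLoop (y, h y)).2 0 := hx0'.snd
  have hcomp : HasDerivAt (fun t => h (x t).1) (fderiv ℝ h y (c.closedLoop (y, h y)).1) 0 := by
    refine HasFDerivAt.comp_hasDerivAt 0 ?_ hfst
    rw [hx0]
    exact (hh.differentiableAt hy).hasFDerivAt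
  have h0 : (0 : ℝ) ∈ Ico 0 T := ⟨le_rfl, hT0⟩
  have huniq : UniqueDiffWithinAt ℝ (Ico 0 T) 0 := (uniqueDiffOn_Ico 0 T) 0 h0
  have h1 : HasDerivWithinAt (fun t => (x t).2) (fderiv ℝ h y (c.closedLoop (y, h y)).1)
      (Ico 0 T) 0 := hcomp.hasDerivWithinAt.congr hinv (hinv 0 h0)
  have h2 := huniq.eq_deriv (Ico 0 T) h1 hsnd.hasDerivWithinAt
  simpa [closedLoop, hA₁, zero_app] using h2

/-- The `v` equation under an arbitrary input, compared with the closed loop. -/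
theorem fz_sub_fy (hc : c.Admissible) (hA₁ : c.A₁ = 0) (y y' : Vec k) (v v' : Vec l) :
    c.fz y (v + app c.E y) (c.ctrl y' (v' + app c.E y'))
        - app c.E (c.fy y (v + app c.E y) (c.ctrl y' (v' + app c.E y')))
      = app c.AK v + c.gc₂ y v
        + app c.B₂ (app (c.K₁₂ + c.K₁₁ * c.E) (y' - y) + app c.K₁₁ (v' - v))
        + (app c.B₂ (c.Kₙ y') - app c.B₂ (c.Kₙ y))
        + (c.g₂ (y, v + app c.E y, c.ctrl y' (v' + app c.E y'))
            - c.g₂ (y, v + app c.E y, c.ctrl y (v + app c.E y)))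
        - app c.E (c.g₁ (y, v + app c.E y, c.ctrl y' (v' + app c.E y'))
            - c.g₁ (y, v + app c.E y, c.ctrl y (v + app c.E y))) := by
  have hE := congrArg (fun M => app M y) hc.E_eq
  simp only [hA₁, Matrix.mul_zero, sub_zero, add_app, mul_app, zero_app, AK] at hE
  have hE' : app c.A₂ (app c.E y) = -(app c.B₂ (app c.K₁₁ (app c.E y)) + app c.B₂ (app c.K₁₂ y)) := by
    rw [eq_neg_iff_add_eq_zero, ← add_assoc]; exact hE
  simp only [fz, fy, gc₂, hA₁, zero_app, zero_add, AK, add_app, mul_app, app_add, app_sub, hE']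
  generalize c.g₁ (y, v + app c.E y, c.ctrl y' (v' + app c.E y')) = a1
  generalize c.g₂ (y, v + app c.E y, c.ctrl y' (v' + app c.E y')) = a2
  simp only [ctrl, app_add]
  abel

/-- The `y` equation under an arbitrary input, compared with the reduced system. -/
theorem fy_sub_gc₁ (hA₁ : c.A₁ = 0) (y : Vec k) (v : Vec l) (u : Vec m) :
    c.fy y (v + app c.E y) u - c.gc₁ y (h y) = (c.gc₁ y v - c.gc₁ y (h y))
      + (c.g₁ (y, v + app c.E y, u) - c.g₁ (y, v + app c.E y, c.ctrl y (v + app c.E y))) := by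
  simp [fy, gc₁, hA₁, zero_app]

/-- The Lipschitz estimates near the origin for all terms by which the sampled loop differs from
its linear part; only the constant `M` is not at our disposal. -/
theorem exists_radius_increments (hc : c.Admissible) (hh : c.IsCenterManifold ρ h) :
    ∃ M > 0, ∀ ε > 0, ε ≤ 1 → ∃ r > 0, r ≤ ρ ∧
      ∀ (y y' : Vec k) (v v' : Vec l), ‖y‖ < r → ‖y'‖ < r → ‖v‖ < r → ‖v'‖ < r →
      ‖c.g₁ (y, v + app c.E y, c.ctrl y' (v' + app c.E y'))
        - c.g₁ (y, v + app c.E y, c.ctrl y (v + app c.E y))‖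
          ≤ ε * (M * pairNorm (y' - y) (v' - v)) ∧
      ‖c.g₂ (y, v + app c.E y, c.ctrl y' (v' + app c.E y'))
        - c.g₂ (y, v + app c.E y, c.ctrl y (v + app c.E y))‖
          ≤ ε * (M * pairNorm (y' - y) (v' - v)) ∧
      ‖c.gc₁ y v - c.gc₁ y (h y)‖ ≤ ε * ‖v - h y‖ ∧
      ‖c.gc₂ y v - c.gc₂ y (h y)‖ ≤ ε * ‖v - h y‖ ∧
      ‖app c.B₂ (c.Kₙ y') - app c.B₂ (c.Kₙ y)‖ ≤ ε * pairNorm (y' - y) (v' - v) ∧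
      ‖c.gc₁ y (h y)‖ ≤ ‖y‖ ∧ ‖h y‖ ≤ ‖y‖ ∧ ‖h y - h y'‖ ≤ ‖y - y'‖ ∧ ‖fderiv ℝ h y‖ ≤ ε := by
  obtain ⟨M, hM, rM, hrM, hctrl⟩ := exists_ctrl_lipschitz hc
  obtain ⟨nE, hnE⟩ : ∃ x, x = ‖appL c.E‖ := ⟨_, rfl⟩
  have hnE0 : 0 ≤ nE := hnE ▸ norm_nonneg _
  have hEle : ∀ x, ‖app c.E x‖ ≤ nE * ‖x‖ := fun x => hnE ▸ norm_app_le c.E x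
  refine ⟨M * (2 + nE), by positivity, fun ε₁ hε₁0 hε₁1 => ?_⟩
  have hstr : HasStrictFDerivAt h (0 : Vec k →L[ℝ] Vec l) 0 := by
    have := (hh.contDiffAt (y := 0) (by simpa using hh.radius_pos)).hasStrictFDerivAt one_ne_zero
    rwa [hh.tangent] at this
  obtain ⟨r₁, hr₁, hg₁⟩ := exists_lipschitz_of_strict_zero (g₁_strict hc) hε₁0
  obtain ⟨r₂, hr₂, hg₂⟩ := exists_lipschitz_of_strict_zero (g₂_strict hc) hε₁0
  obtain ⟨r₃, hr₃, hgc₁⟩ := exists_lipschitz_of_strict_zero (gc₁_strict hc) hε₁0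
  obtain ⟨r₄, hr₄, hgc₂⟩ := exists_lipschitz_of_strict_zero (gc₂_strict hc) hε₁0
  obtain ⟨r₅, hr₅, hK⟩ := exists_lipschitz_of_strict_zero (B₂_Kₙ_strict hc) hε₁0
  obtain ⟨r₆, hr₆, hhl⟩ := exists_lipschitz_of_strict_zero hstr hε₁0
  have hρ := hh.radius_pos
  obtain ⟨R, hR0, q₁, q₂, q₃, q₄, q₅, q₆, qM, qρ⟩ : ∃ R > 0, R ≤ r₁ ∧ R ≤ r₂ ∧ R ≤ r₃ ∧ R ≤ r₄ ∧
      R ≤ r₅ ∧ R ≤ r₆ ∧ R ≤ rM ∧ R ≤ ρ := by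
    refine ⟨min (min r₁ r₂) (min (min r₃ r₄) (min (min r₅ r₆) (min rM ρ))), ?_, ?_⟩
    · simp only [gt_iff_lt, lt_min_iff]; tauto
    · simp only [min_le_iff, le_refl, true_or, or_true, and_self]
  -- the arguments `(y, z, u)` of the nonlinearities have norm at most `C * r`
  obtain ⟨C, hC⟩ : ∃ x, x = (1 + nE) * (1 + 2 * M) := ⟨_, rfl⟩
  have hC1 : 1 + nE ≤ C := by rw [hC]; nlinarith [mul_nonneg hnE0 hM.le]
  have hC0 : 0 < C := by linarith
  obtain ⟨r, hr⟩ : ∃ x, x = R / C := ⟨_, rfl⟩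
  have hr0 : 0 < r := hr ▸ div_pos hR0 hC0
  have hRr : R = C * r := by rw [hr]; field_simp
  have hrR : r ≤ R := by rw [hRr]; nlinarith
  refine ⟨r, hr0, hrR.trans qρ, fun y y' v v' hy hy' hv hv' => ?_⟩
  have hyR : ‖y‖ < R := hy.trans_le hrR
  have hyR' : ‖y'‖ < R := hy'.trans_le hrR
  have hvR : ‖v‖ < R := hv.trans_le hrR
  have hhy : ‖h y‖ ≤ ‖y‖ := by
    have : ‖h y‖ ≤ ε₁ * ‖y‖ := by
      simpa [hh.zero] using hhl y 0 (hyR.trans_le q₆) (by simpa using hr₆)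
    exact this.trans (mul_le_of_le_one_left (norm_nonneg _) hε₁1)
  have hz : ∀ (x : Vec k) (b : Vec l), ‖x‖ < r → ‖b‖ < r → ‖b + app c.E x‖ < (1 + nE) * r := by
    intro x b hx hb
    have h1 := norm_add_le b (app c.E x)
    have h2 := hEle x
    have h3 : nE * ‖x‖ ≤ nE * r := by gcongr
    linarith
  have hu : ∀ (x : Vec k) (b : Vec l), ‖x‖ < r → ‖b‖ < r → ‖c.ctrl x (b + app c.E x)‖ < R := by
    intro x b hx hb
    have h1 := hctrl 0 x 0 (b + app c.E x) (by simpa using hrM) (hx.trans_le (hrR.trans qM))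
    rw [ctrl_zero hc, sub_zero, sub_zero, sub_zero] at h1
    have h2 := hz x b hx hb
    have h5 : 0 < (1 + nE) * r := by positivity
    have h4 : M * (‖x‖ + ‖b + app c.E x‖) ≤ M * (2 * ((1 + nE) * r)) := by
      gcongr
      nlinarith
    rw [hRr, hC]
    nlinarith
  have hzR : ‖v + app c.E y‖ < R := by
    refine (hz y v hy hv).trans_le ?_
    rw [hRr]; gcongr
  have huR := hu y v hy hv
  have huR' := hu y' v' hy' hv'
  have hey : ‖y' - y‖ ≤ pairNorm (y' - y) (v' - v) := norm_fst_le_pairNorm _ _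
  have hev : ‖v' - v‖ ≤ pairNorm (y' - y) (v' - v) := norm_snd_le_pairNorm _ _
  generalize pairNorm (y' - y) (v' - v) = e at hey hev ⊢
  have hdu : ‖c.ctrl y' (v' + app c.E y') - c.ctrl y (v + app c.E y)‖ ≤ M * (2 + nE) * e := by
    refine (hctrl y y' _ _ (hyR.trans_le qM) (hyR'.trans_le qM)).trans ?_
    have h1 : ‖v' + app c.E y' - (v + app c.E y)‖ ≤ ‖v' - v‖ + nE * ‖y' - y‖ := by
      have : v' + app c.E y' - (v + app c.E y) = (v' - v) + app c.E (y' - y) := by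
        rw [app_sub]; abel
      rw [this]
      exact (norm_add_le _ _).trans (add_le_add le_rfl (hEle _))
    have h2 : nE * ‖y' - y‖ ≤ nE * e := by gcongr
    rw [mul_assoc]
    refine mul_le_mul_of_nonneg_left ?_ hM.le
    linarith
  have hnorm3 : ∀ (z : Vec l) (u u' : Vec m),
      ‖((y, z, u) : Vec k × Vec l × Vec m) - (y, z, u')‖ = ‖u - u'‖ := by
    intro z u u'
    simp [Prod.norm_def]
  have hlt3 : ∀ (z : Vec l) (u : Vec m), ‖z‖ < R → ‖u‖ < R →
      ‖((y, z, u) : Vec k × Vec l × Vec m)‖ < R := by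
    intro z u hz hu
    simp only [Prod.norm_def, max_lt_iff]
    exact ⟨hyR, hz, hu⟩
  have hnorm2 : ‖((y, v) : Vec k × Vec l) - (y, h y)‖ = ‖v - h y‖ := by simp [Prod.norm_def]
  have hlt2 : ∀ b : Vec l, ‖b‖ < R → ‖((y, b) : Vec k × Vec l)‖ < R := by
    intro b hb
    simp only [Prod.norm_def, max_lt_iff]
    exact ⟨hyR, hb⟩
  have hhyR : ‖h y‖ < R := hhy.trans_lt hyR
  refine ⟨?_, ?_, ?_, ?_, ?_, ?_, hhy, ?_, ?_⟩
  · refine (hg₁ _ _ ((hlt3 _ _ hzR huR').trans_le q₁) ((hlt3 _ _ hzR huR).trans_le q₁)).trans ?_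
    rw [hnorm3]
    gcongr
  · refine (hg₂ _ _ ((hlt3 _ _ hzR huR').trans_le q₂) ((hlt3 _ _ hzR huR).trans_le q₂)).trans ?_
    rw [hnorm3]
    gcongr
  · rw [← hnorm2]
    exact hgc₁ (y, v) (y, h y) ((hlt2 v hvR).trans_le q₃) ((hlt2 (h y) hhyR).trans_le q₃)
  · rw [← hnorm2]
    exact hgc₂ (y, v) (y, h y) ((hlt2 v hvR).trans_le q₄) ((hlt2 (h y) hhyR).trans_le q₄)
  · exact (hK y' y (hyR'.trans_le q₅) (hyR.trans_le q₅)).trans (by gcongr)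
  · have hgz : c.gc₁ 0 0 = 0 := by
      have : ((0 : Vec k), (0 : Vec l), (0 : Vec m)) = 0 := rfl
      simp [gc₁, app_zero, ctrl_zero hc, this, hc.g₁_zero]
    have := hgc₁ (y, h y) (0, 0) ((hlt2 (h y) hhyR).trans_le q₃) (by simpa using hr₃)
    simp only [hgz, sub_zero, Prod.mk_zero_zero] at this
    have hn : ‖((y, h y) : Vec k × Vec l)‖ ≤ ‖y‖ := by simp [Prod.norm_def, hhy]
    exact this.trans ((mul_le_of_le_one_left (norm_nonneg _) hε₁1).trans hn)
  · exact (hhl y y' (hyR.trans_le q₆) (hyR'.trans_le q₆)).trans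
      (mul_le_of_le_one_left (norm_nonneg _) hε₁1)
  · refine norm_fderiv_le_of_lip' ℝ hε₁0.le ?_
    filter_upwards [Metric.isOpen_ball.mem_nhds
      (show y ∈ Metric.ball (0 : Vec k) R by simpa using hyR)] with x hx
    have hx' : ‖x‖ < R := by simpa using hx
    exact hhl x y (hx'.trans_le q₆) (hyR.trans_le q₆)

/-- Near the origin the sampled loop, in the coordinates `(y, w)` with `w = v - h y`, is the
reduced system in `y` and the linear system `ẇ = A_K w + B₂ K₁ e` in `w`, up to an arbitrarily
small multiple of `‖w‖ + ‖e‖`. -/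
theorem exists_radius_perturbation (hc : c.Admissible) (hh : c.IsCenterManifold ρ h)
    (hA₁ : c.A₁ = 0) {ε : ℝ} (hε : 0 < ε) :
    ∃ r > 0, r ≤ ρ ∧ ∀ (y y' : Vec k) (v v' : Vec l), ‖y‖ < r → ‖y'‖ < r → ‖v‖ < r → ‖v'‖ < r →
      ‖c.fy y (v + app c.E y) (c.ctrl y' (v' + app c.E y')) - c.gc₁ y (h y)‖
        ≤ ε * (‖v - h y‖ + pairNorm (y' - y) (v' - v)) ∧
      ‖c.fz y (v + app c.E y) (c.ctrl y' (v' + app c.E y'))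
          - app c.E (c.fy y (v + app c.E y) (c.ctrl y' (v' + app c.E y')))
          - fderiv ℝ h y (c.fy y (v + app c.E y) (c.ctrl y' (v' + app c.E y')))
          - (app c.AK (v - h y)
            + app c.B₂ (app (c.K₁₂ + c.K₁₁ * c.E) (y' - y) + app c.K₁₁ (v' - v)))‖
        ≤ ε * (‖v - h y‖ + pairNorm (y' - y) (v' - v)) ∧
      ‖c.gc₁ y (h y)‖ ≤ ‖y‖ ∧ ‖h y‖ ≤ ‖y‖ ∧ ‖h y - h y'‖ ≤ ‖y - y'‖ ∧ ‖fderiv ℝ h y‖ ≤ 1 := by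
  obtain ⟨M, hM, hinc⟩ := exists_radius_increments hc hh
  obtain ⟨nE, hnE⟩ : ∃ x, x = ‖appL c.E‖ := ⟨_, rfl⟩
  have hnE0 : 0 ≤ nE := hnE ▸ norm_nonneg _
  have hEle : ∀ x, ‖app c.E x‖ ≤ nE * ‖x‖ := fun x => hnE ▸ norm_app_le c.E x
  -- `D` bounds the coefficients of `‖w‖` and `‖e‖` in both final estimates
  obtain ⟨D, hD⟩ : ∃ x, x = 3 + 2 * M + nE * M := ⟨_, rfl⟩
  have hME : 0 ≤ nE * M := by positivity
  have hD0 : 0 < D := by rw [hD]; positivity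
  obtain ⟨ε₁, hε₁0, hε₁1, hε₁ε⟩ : ∃ x > 0, x ≤ 1 ∧ x * D ≤ ε :=
    ⟨min 1 (ε / D), lt_min one_pos (div_pos hε hD0), min_le_left _ _, by
      rw [← le_div_iff₀ hD0]; exact min_le_right _ _⟩
  obtain ⟨r, hr0, hrρ, hr⟩ := hinc ε₁ hε₁0 hε₁1
  refine ⟨r, hr0, hrρ, fun y y' v v' hy hy' hv hv' => ?_⟩
  obtain ⟨hΔ₁, hΔ₂, hΔ₃, hΔ₄, hΔ₅, hb, hhy, hhl, hDh⟩ := hr y y' v v' hy hy' hv hv'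
  have he0 : 0 ≤ pairNorm (y' - y) (v' - v) := pairNorm_nonneg _ _
  have hw0 := norm_nonneg (v - h y)
  generalize pairNorm (y' - y) (v' - v) = e at *
  have h1 : ‖c.fy y (v + app c.E y) (c.ctrl y' (v' + app c.E y')) - c.gc₁ y (h y)‖
      ≤ ε₁ * ‖v - h y‖ + ε₁ * (M * e) := by
    rw [fy_sub_gc₁ hA₁]
    exact (norm_add_le _ _).trans (add_le_add hΔ₃ hΔ₁)
  have hfin : ∀ a b : ℝ, a ≤ D → b ≤ D → ε₁ * (a * ‖v - h y‖ + b * e) ≤ ε * (‖v - h y‖ + e) := by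
    intro a b ha hb
    calc ε₁ * (a * ‖v - h y‖ + b * e) ≤ ε₁ * (D * ‖v - h y‖ + D * e) := by gcongr
      _ = ε₁ * D * (‖v - h y‖ + e) := by ring
      _ ≤ _ := by gcongr
  refine ⟨h1.trans ?_, ?_, hb, hhy, hhl, hDh.trans hε₁1⟩
  · exact le_of_eq_of_le (by ring) (hfin 1 M (by rw [hD]; linarith) (by rw [hD]; linarith))
  · have hinv := IsCenterManifold.fderiv_apply hc hh hA₁ (y := y) (hy.trans_le hrρ)
    obtain ⟨f, hf⟩ : ∃ f, f = c.fy y (v + app c.E y) (c.ctrl y' (v' + app c.E y')) := ⟨_, rfl⟩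
    -- by invariance of the graph, `Dh(y)` applied to the reduced field cancels `A_K h(y) + gc₂`
    have hsplit : fderiv ℝ h y f = fderiv ℝ h y (f - c.gc₁ y (h y))
        + (app c.AK (h y) + c.gc₂ y (h y)) := by
      rw [map_sub, hinv]; abel
    rw [fz_sub_fy hc hA₁, ← hf, hsplit]
    rw [← hf] at h1
    have hrew : ∀ a b d x₁ x₂ x₃ x₄ x₅ x₆ : Vec l,
        a + b + d + x₁ + x₂ - x₃ - (x₄ + (x₅ + x₆)) - (a - x₅ + d)
          = (b - x₆) + x₁ + x₂ - x₃ - x₄ := by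
      intros; abel
    rw [app_sub c.AK, hrew]
    have hDf : ‖fderiv ℝ h y (f - c.gc₁ y (h y))‖ ≤ 1 * (ε₁ * ‖v - h y‖ + ε₁ * (M * e)) :=
      ((fderiv ℝ h y).le_opNorm _).trans
        (mul_le_mul (hDh.trans hε₁1) h1 (norm_nonneg _) zero_le_one)
    have hEΔ := (hEle _).trans (mul_le_mul_of_nonneg_left hΔ₁ hnE0)
    refine (norm_sub_le _ _).trans ((add_le_add ((norm_sub_le _ _).trans
      (add_le_add (norm_add₃_le.trans
        (add_le_add (add_le_add hΔ₄ hΔ₅) hΔ₂)) hEΔ)) hDf).trans ?_)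
    exact le_of_eq_of_le (by ring)
      (hfin 2 (1 + 2 * M + nE * M) (by rw [hD]; linarith) (by rw [hD]; linarith))

end Loop

/-! ### Decay of the Lyapunov function along the sampled loop -/

section Algebra

variable {k l m : ℕ} {c : Loop k l m}

open scoped Matrix.Norms.L2Operator in
theorem opNorm_nonneg {ι κ : Type} [Fintype ι] [DecidableEq ι] [Fintype κ] [DecidableEq κ]
    (M : Matrix ι κ ℝ) : 0 ≤ opNorm M := norm_nonneg M

open scoped Matrix.Norms.L2Operator in
/-- A block row acts on a concatenated vector, so that its induced norm bounds the sum. -/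
theorem norm_app_add_app_le {a : ℕ} (M : Matrix (Fin a) (Fin k) ℝ) (N : Matrix (Fin a) (Fin l) ℝ)
    (y : Vec k) (v : Vec l) :
    ‖app M y + app N v‖ ≤ opNorm (Matrix.fromCols M N) * pairNorm y v := by
  have h := Matrix.l2_opNorm_mulVec (Matrix.fromCols M N)
    (WithLp.toLp 2 (Sum.elim y.ofLp v.ofLp) : EuclideanSpace ℝ (Fin k ⊕ Fin l))
  have h1 : ‖(WithLp.toLp 2 (Sum.elim y.ofLp v.ofLp) : EuclideanSpace ℝ (Fin k ⊕ Fin l))‖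
      = pairNorm y v := by
    rw [EuclideanSpace.norm_eq, Fintype.sum_sum_type, pairNorm, EuclideanSpace.norm_sq_eq,
      EuclideanSpace.norm_sq_eq]
    rfl
  rw [h1] at h
  refine le_of_eq_of_le ?_ h
  congr 1
  apply WithLp.ofLp_injective 2
  simp [app, Matrix.toLpLin_apply]

theorem norm_P_B₂_K₁_le (P : Matrix (Fin l) (Fin l) ℝ) (y : Vec k) (v : Vec l) :
    ‖app P (app c.B₂ (app (c.K₁₂ + c.K₁₁ * c.E) y + app c.K₁₁ v))‖
      ≤ opNorm (P * c.B₂ * c.K₁) * pairNorm y v := by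
  have h1 : P * c.B₂ * c.K₁
      = Matrix.fromCols (P * c.B₂ * (c.K₁₂ + c.K₁₁ * c.E)) (P * c.B₂ * c.K₁₁) := by
    rw [Loop.K₁, Matrix.mul_fromCols]
  rw [h1]
  refine le_of_eq_of_le ?_ (norm_app_add_app_le _ _ y v)
  simp only [mul_app, app_add]

theorem exists_norm_B₂_K₁_le (c : Loop k l m) : ∃ C ≥ 0, ∀ (y : Vec k) (v : Vec l),
    ‖app c.B₂ (app (c.K₁₂ + c.K₁₁ * c.E) y + app c.K₁₁ v)‖ ≤ C * pairNorm y v := by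
  refine ⟨opNorm (Matrix.fromCols (c.B₂ * (c.K₁₂ + c.K₁₁ * c.E)) (c.B₂ * c.K₁₁)),
    opNorm_nonneg _, fun y v => ?_⟩
  refine le_of_eq_of_le ?_ (norm_app_add_app_le _ _ y v)
  simp only [mul_app, app_add]

/-- The Lyapunov equation as an identity of quadratic forms. -/
theorem inner_app_app_of_lyapunov {P Q A : Matrix (Fin l) (Fin l) ℝ} (hP : P.PosDef)
    (hPQ : Aᵀ * P + P * A = -Q) (w : Vec l) :
    inner ℝ w (app P (app A w)) = -(1 / 2) * inner ℝ w (app Q w) := by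
  have hPt : Pᵀ = P := by simpa using hP.1.eq
  have h1 := congrArg (fun M => inner ℝ w (app M w)) hPQ
  simp only [add_app, mul_app, neg_app, inner_add_right, inner_neg_right] at h1
  have h2 : inner ℝ w (app Aᵀ (app P w)) = inner ℝ w (app P (app A w)) := by
    rw [real_inner_comm, inner_app_transpose, ← inner_app_transpose P, hPt]
  rw [h2] at h1
  linarith

/-- Decay of `√(wᵀ P w)` along `ẇ = A_K w + B₂ K₁ e + o(‖w‖ + ‖e‖)` when `‖e‖` obeys the
triggering rule. The number `Y` stands for `‖y‖^(p+1)`, and `d` for the right derivative of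
`√(wᵀ P w)`. -/
theorem exists_wnorm_deriv_le (hl : 0 < l) {P Q : Matrix (Fin l) (Fin l) ℝ} (hP : P.PosDef)
    (hQ : Q.PosDef) (hPQ : c.AKᵀ * P + P * c.AK = -Q) {sf : ℝ} (hsf : sf ∈ Ioo (0 : ℝ) 1)
    {sig : ℝ} (hsig : 0 < sig)
    (hsig' : sig * (2 * opNorm (P * c.B₂ * c.K₁) * √(lamMax P)) ≤
      (1 - sf) * lamMin Q * √(lamMin P)) :
    ∃ a₀ > 0, ∃ c₁ ≥ 0, ∃ C ≥ 0, ∀ (w w' : Vec l) (ey : Vec k) (ev : Vec l) (d ε Y : ℝ),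
      d * wnorm P w = inner ℝ w (app P w') → (w = 0 → d = wnorm P w') → 0 ≤ ε → ε ≤ 1 → 0 ≤ Y →
      pairNorm ey ev ≤ sig * (‖w‖ + Y) →
      ‖w' - (app c.AK w + app c.B₂ (app (c.K₁₂ + c.K₁₁ * c.E) ey + app c.K₁₁ ev))‖
        ≤ ε * (‖w‖ + pairNorm ey ev) →
      d ≤ -(a₀ - ε * c₁) * ‖w‖ + C * Y := by
  have hlm := lamMin_pos hl hP
  have hlM := hlm.trans_le (lamMin_le_lamMax hl hP)
  have hlQ := lamMin_pos hl hQ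
  obtain ⟨CB, hCB, hB⟩ := exists_norm_B₂_K₁_le c
  obtain ⟨b, hb⟩ : ∃ x, x = opNorm (P * c.B₂ * c.K₁) := ⟨_, rfl⟩
  obtain ⟨μ, hμ⟩ : ∃ x, x = √(lamMin P) := ⟨_, rfl⟩
  obtain ⟨ν, hν⟩ : ∃ x, x = √(lamMax P) := ⟨_, rfl⟩
  obtain ⟨q, hq⟩ : ∃ x, x = lamMin Q := ⟨_, rfl⟩
  obtain ⟨π, hπ⟩ : ∃ x, x = ‖appL P‖ := ⟨_, rfl⟩
  have hb0 : 0 ≤ b := hb ▸ opNorm_nonneg _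
  have hμ0 : 0 < μ := hμ ▸ Real.sqrt_pos.2 hlm
  have hν0 : 0 < ν := hν ▸ Real.sqrt_pos.2 hlM
  have hμν : μ ≤ ν := by rw [hμ, hν]; exact Real.sqrt_le_sqrt (lamMin_le_lamMax hl hP)
  have hq0 : 0 < q := hq ▸ hlQ
  have hπ0 : 0 ≤ π := hπ ▸ norm_nonneg _
  obtain ⟨hsf0, hsf1⟩ := hsf
  rw [← hb, ← hμ, ← hν, ← hq] at hsig'
  -- only this consequence of the bound on `σ` is needed
  have hσb : sig * b ≤ (1 - sf) * q / 2 := by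
    have : (sig * b) * (2 * ν) ≤ ((1 - sf) * q / 2) * (2 * ν) := by
      have : (1 - sf) * q * μ ≤ (1 - sf) * q * ν :=
        mul_le_mul_of_nonneg_left hμν (mul_nonneg (by linarith) hq0.le)
      linarith
    exact le_of_mul_le_mul_right this (by linarith)
  refine ⟨sf * q / (2 * ν), by positivity, π * (1 + sig) / μ, by positivity,
    (b * sig + π * sig) / μ + ν * ((CB + 1) * sig), by positivity,
    fun w w' ey ev d ε Y hd hd0 hε hε1 hY he hr => ?_⟩
  have he0 : 0 ≤ pairNorm ey ev := pairNorm_nonneg _ _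
  have hBe := hB ey ev
  have hPBe := norm_P_B₂_K₁_le (c := c) P ey ev
  rw [← hb] at hPBe
  generalize app c.B₂ (app (c.K₁₂ + c.K₁₁ * c.E) ey + app c.K₁₁ ev) = Be at *
  generalize pairNorm ey ev = e at *
  obtain ⟨r, hrdef⟩ : ∃ r, r = w' - (app c.AK w + Be) := ⟨_, rfl⟩
  rw [← hrdef] at hr
  have hw' : w' = app c.AK w + Be + r := by rw [hrdef]; abel
  by_cases hw : w = 0
  -- at `w = 0` the derivative is `√(w'ᵀ P w')`, and the rule gives `‖e‖ ≤ σ Y`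
  · rw [hd0 hw]
    have h1 := wnorm_le_sqrt_lamMax_mul hl hP w'
    rw [← hν] at h1
    have h2 : ‖w'‖ ≤ (CB + 1) * sig * Y := by
      rw [hw', hw, app_zero, zero_add]
      rw [hw, norm_zero, zero_add] at hr he
      calc ‖Be + r‖ ≤ CB * e + ε * e := (norm_add_le _ _).trans (add_le_add hBe hr)
        _ ≤ CB * e + 1 * e := by gcongr
        _ = (CB + 1) * e := by ring
        _ ≤ (CB + 1) * (sig * Y) := by gcongr
        _ = _ := by ring
    rw [hw, norm_zero, mul_zero, zero_add]
    calc wnorm P w' ≤ ν * ((CB + 1) * sig * Y) := h1.trans (by gcongr)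
      _ = ν * ((CB + 1) * sig) * Y := by ring
      _ ≤ _ := by
        gcongr
        have : 0 ≤ (b * sig + π * sig) / μ := by positivity
        linarith
  · have hn : 0 < ‖w‖ := norm_pos_iff.2 hw
    have hWl := sqrt_lamMin_mul_le_wnorm hl hP w
    have hWu := wnorm_le_sqrt_lamMax_mul hl hP w
    rw [← hμ] at hWl
    rw [← hν] at hWu
    have hquad := lamMin_mul_le_inner hQ.1 w
    rw [← hq] at hquad
    have hin : inner ℝ w (app P w')
        ≤ -(1 / 2) * (q * ‖w‖ ^ 2) + ‖w‖ * (b * e) + ‖w‖ * (π * (ε * (‖w‖ + e))) := by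
      rw [hw', app_add, app_add, inner_add_right, inner_add_right, inner_app_app_of_lyapunov hP hPQ]
      have h1 : inner ℝ w (app P Be) ≤ ‖w‖ * (b * e) :=
        (real_inner_le_norm _ _).trans (by gcongr)
      have h2 : inner ℝ w (app P r) ≤ ‖w‖ * (π * (ε * (‖w‖ + e))) := by
        refine (real_inner_le_norm _ _).trans ?_
        gcongr
        refine (norm_app_le P r).trans ?_
        rw [← hπ]
        gcongr
      linarith
    rw [← hd] at hin
    generalize wnorm P w = W at *
    generalize ‖w‖ = n at *
    have hW0 : 0 < W := (mul_pos hμ0 hn).trans_le hWl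
    refine le_of_mul_le_mul_right (hin.trans ?_) hW0
    have hnW : n ≤ W / μ := by rw [le_div_iff₀ hμ0]; linarith
    have hWn : W / ν ≤ n := by rw [div_le_iff₀ hν0]; linarith
    -- the quadratic terms of the input error are absorbed by the part `1 - s_f` of the decay
    have h1 : n * (b * e) ≤ (1 - sf) * q / 2 * n ^ 2 + W / μ * (b * sig * Y) := by
      calc n * (b * e) ≤ n * (b * (sig * (n + Y))) := by gcongr
        _ = sig * b * n ^ 2 + n * (b * sig * Y) := by ring
        _ ≤ _ := by gcongr
    have h2 : n * (π * (ε * (n + e))) ≤ W / μ * (π * (ε * ((1 + sig) * n)) + π * (sig * Y)) := by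
      calc n * (π * (ε * (n + e))) ≤ n * (π * (ε * (n + sig * (n + Y)))) := by gcongr
        _ = n * (π * (ε * ((1 + sig) * n)) + π * (ε * (sig * Y))) := by ring
        _ ≤ n * (π * (ε * ((1 + sig) * n)) + π * (1 * (sig * Y))) := by gcongr
        _ ≤ W / μ * (π * (ε * ((1 + sig) * n)) + π * (sig * Y)) := by
            rw [one_mul]; gcongr
    have h3 : sf * q / 2 * n * (W / ν) ≤ sf * q / 2 * n * n := by gcongr
    have h4 : 0 ≤ ν * ((CB + 1) * sig) * Y * W := by positivity
    calc _ ≤ -(sf * q / 2 * n * n) + W / μ * (b * sig * Y)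
          + W / μ * (π * (ε * ((1 + sig) * n)) + π * (sig * Y)) := by linarith
      _ ≤ -(sf * q / 2 * n * (W / ν)) + W / μ * (b * sig * Y)
          + W / μ * (π * (ε * ((1 + sig) * n)) + π * (sig * Y))
          + ν * ((CB + 1) * sig) * Y * W := by linarith
      _ = _ := by field_simp; ring

/-- Decay of `‖y‖`; `d` stands for its right derivative. -/
theorem norm_deriv_le {y f g : Vec k} {d p k₆ η : ℝ} (hp : 1 < p)
    (hd : d * ‖y‖ = inner ℝ y f) (hd0 : y = 0 → d = ‖f‖) (hg : ‖g‖ ≤ ‖y‖)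
    (hg₆ : inner ℝ y g ≤ -k₆ * ‖y‖ ^ (p + 1)) (hfg : ‖f - g‖ ≤ η) :
    d ≤ -k₆ * ‖y‖ ^ p + η := by
  by_cases hy : y = 0
  · have hg0 : g = 0 := by simpa [hy] using hg
    rw [hd0 hy, hy, norm_zero, Real.zero_rpow (by linarith)]
    simpa [hg0] using hfg
  · have hn : 0 < ‖y‖ := norm_pos_iff.2 hy
    refine le_of_mul_le_mul_right ?_ hn
    have h1 : inner ℝ y f = inner ℝ y g + inner ℝ y (f - g) := by rw [← inner_add_right]; simp
    have h2 : inner ℝ y (f - g) ≤ ‖y‖ * η := (real_inner_le_norm _ _).trans (by gcongr)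
    rw [Real.rpow_add_one hn.ne'] at hg₆
    rw [hd, h1]
    linarith

end Algebra

section Local

variable {k l m : ℕ} {c : Loop k l m} {ρ : ℝ} {h : Vec k → Vec l}

theorem hasDerivWithinAt_wco (hh : c.IsCenterManifold ρ h) {y : ℝ → Vec k} {z : ℝ → Vec l}
    {y' : Vec k} {z' : Vec l} {s : ℝ} {S : Set ℝ} (hy : HasDerivWithinAt y y' S s)
    (hz : HasDerivWithinAt z z' S s) (hs : ‖y s‖ < ρ) :
    HasDerivWithinAt (fun t => c.wco h (y t) (z t))
      (z' - app c.E y' - fderiv ℝ h (y s) y') S s :=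
  (hz.sub ((appL c.E).hasFDerivAt.comp_hasDerivWithinAt s hy)).sub
    ((hh.differentiableAt hs).hasFDerivAt.comp_hasDerivWithinAt s hy)

/-- A growth constant from the perturbation estimate with `ε = 1`. The radius `2 δ ≤ r` is due to
`‖v‖ ≤ ‖w‖ + ‖h(y)‖ < 2 δ`. -/
theorem exists_growthConst (c : Loop k l m) {r δ : ℝ} (hδ : 2 * δ ≤ r)
    (hpert : ∀ (y y' : Vec k) (v v' : Vec l), ‖y‖ < r → ‖y'‖ < r → ‖v‖ < r → ‖v'‖ < r →
      ‖c.fy y (v + app c.E y) (c.ctrl y' (v' + app c.E y')) - c.gc₁ y (h y)‖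
        ≤ ‖v - h y‖ + pairNorm (y' - y) (v' - v) ∧
      ‖c.fz y (v + app c.E y) (c.ctrl y' (v' + app c.E y'))
          - app c.E (c.fy y (v + app c.E y) (c.ctrl y' (v' + app c.E y')))
          - fderiv ℝ h y (c.fy y (v + app c.E y) (c.ctrl y' (v' + app c.E y')))
          - (app c.AK (v - h y)
            + app c.B₂ (app (c.K₁₂ + c.K₁₁ * c.E) (y' - y) + app c.K₁₁ (v' - v)))‖
        ≤ ‖v - h y‖ + pairNorm (y' - y) (v' - v) ∧
      ‖c.gc₁ y (h y)‖ ≤ ‖y‖ ∧ ‖fderiv ℝ h y‖ ≤ 1)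
    (hhr : ∀ y, ‖y‖ < r → ‖h y‖ ≤ ‖y‖) :
    ∃ L > 0, IsGrowthConst c h δ L := by
  obtain ⟨CB, hCB, hB⟩ := exists_norm_B₂_K₁_le c
  -- `3` from `ẏ`, and `2 + 3 + ‖A_K‖ + CB` from `v̇`
  refine ⟨8 + ‖appL c.AK‖ + CB, by positivity, fun y y' w w' hq hq' => ?_⟩
  have hy : ‖y‖ < δ := (norm_fst_le_pairNorm y w).trans_lt hq
  have hw : ‖w‖ < δ := (norm_snd_le_pairNorm y w).trans_lt hq
  have hy' : ‖y'‖ < δ := (norm_fst_le_pairNorm y' w').trans_lt hq'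
  have hw' : ‖w'‖ < δ := (norm_snd_le_pairNorm y' w').trans_lt hq'
  have hδ0 : 0 < δ := (norm_nonneg y).trans_lt hy
  have hv : ∀ (x : Vec k) (b : Vec l), ‖x‖ < δ → ‖b‖ < δ → ‖b + h x‖ < r := by
    intro x b hx hb
    have := norm_add_le b (h x)
    have := hhr x (by linarith)
    linarith
  obtain ⟨h1, h2, h3, h4⟩ := hpert y y' (w + h y) (w' + h y') (by linarith) (by linarith)
    (hv y w hy hw) (hv y' w' hy' hw')
  have hroot : √(‖y‖ ^ 2 + ‖w‖ ^ 2 + ‖y' - y‖ ^ 2 + ‖w' + h y' - (w + h y)‖ ^ 2)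
      = √(‖y‖ ^ 2 + ‖w‖ ^ 2 + pairNorm (y' - y) (w' + h y' - (w + h y)) ^ 2) := by
    rw [pairNorm_sq]; ring_nf
  have hBe := hB (y' - y) (w' + h y' - (w + h y))
  have he0 : 0 ≤ pairNorm (y' - y) (w' + h y' - (w + h y)) := pairNorm_nonneg _ _
  dsimp only
  rw [hroot]
  rw [add_sub_cancel_right] at h1 h2
  generalize app c.B₂ (app (c.K₁₂ + c.K₁₁ * c.E) (y' - y)
    + app c.K₁₁ (w' + h y' - (w + h y))) = Be at *
  generalize pairNorm (y' - y) (w' + h y' - (w + h y)) = e at *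
  generalize c.fz y (w + h y + app c.E y) (c.ctrl y' (w' + h y' + app c.E y')) = fz at *
  generalize c.fy y (w + h y + app c.E y) (c.ctrl y' (w' + h y' + app c.E y')) = fy at *
  obtain ⟨R, hR⟩ : ∃ R, R = √(‖y‖ ^ 2 + ‖w‖ ^ 2 + e ^ 2) := ⟨_, rfl⟩
  have hR1 : ‖y‖ ≤ R := hR ▸ Real.le_sqrt_of_sq_le (by nlinarith [sq_nonneg ‖w‖, sq_nonneg e])
  have hR2 : ‖w‖ ≤ R := hR ▸ Real.le_sqrt_of_sq_le (by nlinarith [sq_nonneg ‖y‖, sq_nonneg e])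
  have hR3 : e ≤ R := hR ▸ Real.le_sqrt_of_sq_le (by nlinarith [sq_nonneg ‖w‖, sq_nonneg ‖y‖])
  rw [← hR]
  have hfy : ‖fy‖ ≤ 3 * R := by
    have := norm_le_norm_sub_add fy (c.gc₁ y (h y))
    linarith
  have hD : ‖fderiv ℝ h y fy‖ ≤ 3 * R :=
    ((fderiv ℝ h y).le_opNorm fy).trans
      ((mul_le_of_le_one_left (norm_nonneg _) h4).trans hfy)
  have hA : ‖app c.AK w‖ ≤ ‖appL c.AK‖ * R := (norm_app_le _ _).trans (by gcongr)
  have hBe' : ‖Be‖ ≤ CB * R := hBe.trans (by gcongr)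
  have hfz : ‖fz - app c.E fy‖ ≤ 2 * R + 3 * R + (‖appL c.AK‖ * R + CB * R) := by
    have hs : fz - app c.E fy = (fz - app c.E fy - fderiv ℝ h y fy - (app c.AK w + Be))
        + fderiv ℝ h y fy + (app c.AK w + Be) := by abel
    rw [hs]
    exact norm_add₃_le.trans (add_le_add (add_le_add (by linarith) hD)
      ((norm_add_le _ _).trans (add_le_add hA hBe')))
  refine (pairNorm_le_add _ _).trans ?_
  linarith

/-- Everything that is needed about the vector fields near the origin: on a ball of radius `δ₀`,
while the error obeys the triggering rule, `V` decays along the sampled loop. -/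
theorem exists_radius_decay (hl : 0 < l) (hc : c.Admissible) (hh : c.IsCenterManifold ρ h)
    (hA₁ : c.A₁ = 0) {p k₆ : ℝ} (hp : 1 < p) (hk₆ : 0 < k₆)
    (hg₆ : ∀ᶠ y in 𝓝 (0 : Vec k), inner ℝ y (c.gc₁ y (h y)) ≤ -k₆ * ‖y‖ ^ (p + 1))
    {P Q : Matrix (Fin l) (Fin l) ℝ} (hP : P.PosDef) (hQ : Q.PosDef)
    (hPQ : c.AKᵀ * P + P * c.AK = -Q) {sf : ℝ} (hsf : sf ∈ Ioo (0 : ℝ) 1)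
    {sig : ℝ} (hsig : 0 < sig)
    (hsig' : sig * (2 * opNorm (P * c.B₂ * c.K₁) * √(lamMax P)) ≤
      (1 - sf) * lamMin Q * √(lamMin P)) :
    ∃ a > 0, ∃ δ₀ > 0, δ₀ < ρ ∧ (∀ y, ‖y‖ < δ₀ → ‖h y‖ ≤ ‖y‖) ∧
      (∃ L > 0, IsGrowthConst c h δ₀ L) ∧
      ∀ (y : ℝ → Vec k) (z : ℝ → Vec l) (y' : Vec k) (z' : Vec l) (s : ℝ),
        (y s, c.wco h (y s) (z s)) ∈ pairBall k l δ₀ → (y', c.wco h y' z') ∈ pairBall k l δ₀ →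
        HasDerivWithinAt y (c.fy (y s) (z s) (c.ctrl y' z')) (Ici s) s →
        HasDerivWithinAt z (c.fz (y s) (z s) (c.ctrl y' z')) (Ici s) s →
        pairNorm (y' - y s) (c.vco y' z' - c.vco (y s) (z s))
          ≤ sig * (‖c.wco h (y s) (z s)‖ + ‖y s‖ ^ (p + 1)) →
        ∃ d, HasDerivWithinAt (fun t => lyap P (y t) (c.wco h (y t) (z t))) d (Ici s) s ∧
          d ≤ -a * (‖y s‖ ^ p + ‖c.wco h (y s) (z s)‖) := by
  obtain ⟨a₀, ha₀, c₁, hc₁, C, hC, hW⟩ := exists_wnorm_deriv_le (c := c) hl hP hQ hPQ hsf hsig hsig'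
  -- `ε` is small enough to lose at most half of the rate `a₀` in `‖w‖`
  obtain ⟨D, hD⟩ : ∃ x, x = 2 * (c₁ + 1 + sig) := ⟨_, rfl⟩
  have hD0 : 0 < D := by rw [hD]; positivity
  obtain ⟨ε, hε0, hε1, hεD⟩ : ∃ x > 0, x ≤ 1 ∧ x * D ≤ a₀ :=
    ⟨min 1 (a₀ / D), lt_min one_pos (div_pos ha₀ hD0), min_le_left _ _, by
      rw [← le_div_iff₀ hD0]; exact min_le_right _ _⟩
  obtain ⟨r, hr0, hrρ, hpert⟩ := Loop.exists_radius_perturbation hc hh hA₁ hε0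
  obtain ⟨r₆, hr₆, hg⟩ := Metric.eventually_nhds_iff.1 hg₆
  -- the last bound lets half of `k₆ ‖y‖^p` absorb the multiples of `‖y‖^(p+1)`
  obtain ⟨δ₀, hδ₀, hδr, hδ₆, hδC⟩ : ∃ x > 0, 2 * x ≤ r ∧ x ≤ r₆ ∧ 2 * ((C + sig) * x) ≤ k₆ := by
    refine ⟨min (r / 2) (min r₆ (k₆ / (2 * (C + sig)))), by positivity, ?_, ?_, ?_⟩
    · linarith [min_le_left (r / 2) (min r₆ (k₆ / (2 * (C + sig))))]
    · exact (min_le_right _ _).trans (min_le_left _ _)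
    · have h1 : min (r / 2) (min r₆ (k₆ / (2 * (C + sig)))) ≤ k₆ / (2 * (C + sig)) :=
        (min_le_right _ _).trans (min_le_right _ _)
      rw [le_div_iff₀ (by positivity)] at h1
      linarith
  have hhr : ∀ y, ‖y‖ < r → ‖h y‖ ≤ ‖y‖ := fun y hy =>
    (hpert y y 0 0 hy hy (by simpa using hr0) (by simpa using hr0)).2.2.2.1
  have hkey : ∀ n e : ℝ, 0 ≤ n → 0 ≤ e → ε * (n + e) ≤ n + e := fun n e hn he =>
    mul_le_of_le_one_left (by positivity) hε1
  refine ⟨min (k₆ / 2) (a₀ / 2), by positivity, δ₀, hδ₀, by linarith,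
    fun y hy => hhr y (by linarith), ?_, ?_⟩
  · refine exists_growthConst c hδr (fun y y' v v' hy hy' hv hv' => ?_) hhr
    obtain ⟨h1, h2, h3, -, -, h6⟩ := hpert y y' v v' hy hy' hv hv'
    have := hkey _ _ (norm_nonneg (v - h y)) (pairNorm_nonneg (y' - y) (v' - v))
    exact ⟨h1.trans this, h2.trans this, h3, h6⟩
  · intro y z y' z' s hq hq' hyd hzd he
    have hy : ‖y s‖ < δ₀ := (norm_fst_le_pairNorm _ _).trans_lt hq
    have hw : ‖c.wco h (y s) (z s)‖ < δ₀ := (norm_snd_le_pairNorm _ _).trans_lt hq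
    have hy' : ‖y'‖ < δ₀ := (norm_fst_le_pairNorm _ _).trans_lt hq'
    have hw' : ‖c.wco h y' z'‖ < δ₀ := (norm_snd_le_pairNorm _ _).trans_lt hq'
    have hv : ∀ (x : Vec k) (b : Vec l), ‖x‖ < δ₀ → ‖c.wco h x b‖ < δ₀ → ‖c.vco x b‖ < r := by
      intro x b hx hb
      have h1 : c.vco x b = c.wco h x b + h x := by simp [Loop.wco]
      rw [h1]
      have := norm_add_le (c.wco h x b) (h x)
      have := hhr x (by linarith)
      linarith
    obtain ⟨h1, h2, h3, -, -, -⟩ := hpert (y s) y' (c.vco (y s) (z s)) (c.vco y' z')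
      (by linarith) (by linarith) (hv _ _ hy hw) (hv _ _ hy' hw')
    have hzE : ∀ (x : Vec k) (b : Vec l), c.vco x b + app c.E x = b := by simp [Loop.vco]
    have hwE : c.vco (y s) (z s) - h (y s) = c.wco h (y s) (z s) := rfl
    rw [hzE, hzE, hwE] at h1 h2
    have hwd := hasDerivWithinAt_wco hh hyd hzd (by linarith)
    obtain ⟨d₁, hd₁, hd₁', hd₁0⟩ := exists_hasDerivWithinAt_norm_Ici hyd
    obtain ⟨d₂, hd₂, hd₂', hd₂0⟩ := exists_hasDerivWithinAt_wnorm hP hwd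
    refine ⟨d₁ + d₂, hd₁.add hd₂, ?_⟩
    have hY0 : 0 ≤ ‖y s‖ ^ (p + 1) := by positivity
    have e1 := norm_deriv_le hp hd₁' hd₁0 h3
      (hg (by rw [dist_zero_right]; linarith)) h1
    have e2 := hW _ _ (y' - y s) (c.vco y' z' - c.vco (y s) (z s)) d₂ ε (‖y s‖ ^ (p + 1))
      hd₂' hd₂0 hε0.le hε1 hY0 he h2
    have hYp : ‖y s‖ ^ (p + 1) ≤ δ₀ * ‖y s‖ ^ p := by
      rcases eq_or_ne (y s) 0 with h0 | h0
      · rw [h0, norm_zero, Real.zero_rpow (by linarith), Real.zero_rpow (by linarith), mul_zero]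
      · rw [Real.rpow_add_one (norm_ne_zero_iff.2 h0), mul_comm]
        gcongr
    have hYp0 : 0 ≤ ‖y s‖ ^ p := by positivity
    have hn0 := norm_nonneg (c.wco h (y s) (z s))
    generalize ‖c.wco h (y s) (z s)‖ = n at *
    generalize ‖y s‖ ^ (p + 1) = Y at *
    generalize ‖y s‖ ^ p = Yp at *
    generalize pairNorm (y' - y s) (c.vco y' z' - c.vco (y s) (z s)) = e at *
    have e3 : ε * (n + e) ≤ ε * (1 + sig) * n + sig * Y := by
      calc ε * (n + e) ≤ ε * (n + sig * (n + Y)) := by gcongr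
        _ = ε * (1 + sig) * n + ε * (sig * Y) := by ring
        _ ≤ ε * (1 + sig) * n + 1 * (sig * Y) := by gcongr
        _ = _ := by ring
    have e4 : (C + sig) * Y ≤ k₆ / 2 * Yp := by
      calc (C + sig) * Y ≤ (C + sig) * (δ₀ * Yp) := by gcongr
        _ = (C + sig) * δ₀ * Yp := by ring
        _ ≤ _ := by gcongr; linarith
    have e5 : ε * (c₁ + 1 + sig) * n ≤ a₀ / 2 * n := by
      gcongr
      rw [hD] at hεD
      linarith
    have e6 : min (k₆ / 2) (a₀ / 2) * Yp ≤ k₆ / 2 * Yp := by gcongr; exact min_le_left _ _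
    have e7 : min (k₆ / 2) (a₀ / 2) * n ≤ a₀ / 2 * n := by gcongr; exact min_le_right _ _
    nlinarith

end Local

/-! ### Curves along which the Lyapunov function dissipates -/

theorem eventually_lt_of_hasDerivWithinAt_neg {f : ℝ → ℝ} {d s : ℝ}
    (hf : HasDerivWithinAt f d (Ici s) s) (hd : d < 0) : ∀ᶠ t in 𝓝[>] s, f t < f s := by
  rw [← hasDerivWithinAt_Ioi_iff_Ici, hasDerivWithinAt_iff_tendsto_slope' self_notMem_Ioi] at hf
  filter_upwards [hf.eventually_lt_const hd, self_mem_nhdsWithin] with t ht hts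
  have hts' : 0 < t - s := sub_pos.2 hts
  rw [slope_def_field, div_lt_iff₀ hts', zero_mul] at ht
  linarith

section Levels

variable {k l : ℕ} {P : Matrix (Fin l) (Fin l) ℝ}

theorem pairBall_mono {r r' : ℝ} (h : r ≤ r') : pairBall k l r ⊆ pairBall k l r' :=
  fun _ hq => lt_of_lt_of_le hq h

/-- The radius `r₁ = α₂⁻¹(α₁(r_s))` of `S₂` is less than `r_s`. -/
theorem alpha₂inv_alpha₁_lt {r : ℝ} (hr : 0 < r) : alpha₂inv P (alpha₁ P r) < r := by
  have h1 : min 1 √(lamMin P) ≤ 1 := min_le_left _ _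
  have h2 : 1 ≤ max 1 √(lamMax P) := le_max_left _ _
  have h3 : 1 < √2 := by rw [Real.lt_sqrt zero_le_one]; norm_num
  have h4 : 1 < √2 * max 1 √(lamMax P) := by nlinarith
  rw [alpha₂inv, alpha₁, div_lt_iff₀ (alpha₂_coeff_pos P)]
  calc min 1 √(lamMin P) * r ≤ 1 * r := by gcongr
    _ = r * 1 := mul_comm _ _
    _ < _ := by gcongr

theorem alpha₂inv_alpha₁_pos (hl : 0 < l) (hP : P.PosDef) {r : ℝ} (hr : 0 < r) :
    0 < alpha₂inv P (alpha₁ P r) :=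
  div_pos (mul_pos (alpha₁_coeff_pos hl hP) hr) (alpha₂_coeff_pos P)

theorem lyap_le_of_pairNorm_le (hl : 0 < l) (hP : P.PosDef) {r : ℝ} {y : Vec k} {w : Vec l}
    (h : pairNorm y w ≤ alpha₂inv P (alpha₁ P r)) : lyap P y w ≤ alpha₁ P r := by
  refine (lyap_le_alpha₂ hl hP y w).trans ?_
  rwa [alpha₂inv, le_div_iff₀ (alpha₂_coeff_pos P), mul_comm] at h

theorem pairNorm_lt_of_lyap_lt (hl : 0 < l) (hP : P.PosDef) {r : ℝ} {y : Vec k} {w : Vec l}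
    (h : lyap P y w < alpha₁ P r) : pairNorm y w < r :=
  lt_of_mul_lt_mul_left ((alpha₁_le_lyap hl hP y w).trans_lt h) (alpha₁_coeff_pos hl hP).le

theorem fst_lt_of_mem_Sv {δ : ℝ} {x : Vec k × Vec l}
    (h : x ∈ Sv k P δ) : ‖x.1‖ < δ :=
  (norm_fst_le_pairNorm _ _).trans_lt h.1

/-- Since `k > 0`, there are vectors of every norm below `r` in the ball. -/
theorem le_of_pairBall_subset (hk : 0 < k) {r δ : ℝ} (hr : 0 < r)
    (h : pairBall k l r ⊆ Sv k P δ) : r ≤ δ := by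
  refine le_of_forall_lt fun t ht => ?_
  have hn : pairNorm (EuclideanSpace.single (⟨0, hk⟩ : Fin k) (max t 0)) (0 : Vec l) = max t 0 := by
    simp [pairNorm]
  have h1 : (EuclideanSpace.single (⟨0, hk⟩ : Fin k) (max t 0), (0 : Vec l)) ∈ pairBall k l r := by
    change pairNorm _ _ < r
    rw [hn]
    exact max_lt ht hr
  have h2 : pairNorm (EuclideanSpace.single (⟨0, hk⟩ : Fin k) (max t 0)) (0 : Vec l) < δ :=
    (h h1).1
  rw [hn] at h2
  exact (le_max_left _ _).trans_lt h2

end Levels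

/-- A curve `q = (y;w)` on `[a, b]` along which the Lyapunov function decreases at rate at least
`κ` whenever the state is in the region `S_v \ S₂`. Continuity of `w` is only available where `y`
lies in the domain of the center manifold. -/
structure DissipatesOn {k l : ℕ} (R : Rule k l) (ρ κ : ℝ) (q : ℝ → Vec k × Vec l) (a b : ℝ) :
    Prop where
  fst_cont : ContinuousOn (fun s => (q s).1) (Icc a b)
  cont : ∀ s ∈ Icc a b, ‖(q s).1‖ < ρ → ContinuousWithinAt q (Icc a b) s
  decay : ∀ s ∈ Ico a b, q s ∈ R.active →
    ∃ d ≤ -κ, HasDerivWithinAt (fun t => lyap R.P (q t).1 (q t).2) d (Ici s) s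

namespace DissipatesOn

variable {k l : ℕ} {R : Rule k l} {ρ κ : ℝ} {q : ℝ → Vec k × Vec l} {a b : ℝ}

theorem mono (D : DissipatesOn R ρ κ q a b) {a' b' : ℝ} (ha : a ≤ a') (hb : b' ≤ b) :
    DissipatesOn R ρ κ q a' b' where
  fst_cont := D.fst_cont.mono (Icc_subset_Icc ha hb)
  cont s hs h := (D.cont s (Icc_subset_Icc ha hb hs) h).mono (Icc_subset_Icc ha hb)
  decay s hs h := D.decay s ⟨ha.trans hs.1, hs.2.trans_le hb⟩ h

/-- On `S_v` the component `y` stays in the domain of the center manifold; at the right end point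
this uses `δ < ρ` and the continuity of `y` alone. -/
theorem continuousOn (D : DissipatesOn R ρ κ q a b) (hδ : R.δ < ρ) (hab : a < b)
    (h : ∀ s ∈ Ico a b, q s ∈ Sv k R.P R.δ) : ContinuousOn q (Icc a b) := by
  intro s hs
  refine D.cont s hs (lt_of_le_of_lt ?_ hδ)
  rcases hs.2.eq_or_lt with rfl | hsb
  · have hcl : s ∈ closure (Ico a s) := by rw [closure_Ico hab.ne]; exact hs
    exact ContinuousWithinAt.closure_le hcl
      (((D.fst_cont s hs).norm).mono Ico_subset_Icc_self) continuousWithinAt_const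
      fun t ht => (fst_lt_of_mem_Sv (h t ht)).le
  · exact (fst_lt_of_mem_Sv (h s ⟨hs.1, hsb⟩)).le

/-- Integration of the decay of `V` over a time interval spent in `S_v \ S₂`. -/
theorem lyap_le (D : DissipatesOn R ρ κ q a b) (hδ : R.δ < ρ) (hab : a ≤ b)
    (h : ∀ s ∈ Ico a b, q s ∈ R.active) :
    lyap R.P (q b).1 (q b).2 ≤ lyap R.P (q a).1 (q a).2 - κ * (b - a) := by
  rcases hab.eq_or_lt with rfl | hab'
  · simp
  have hc := D.continuousOn hδ hab' fun s hs => (h s hs).1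
  have hV : ContinuousOn (fun t => lyap R.P (q t).1 (q t).2) (Icc a b) :=
    continuous_lyap.comp_continuousOn hc
  have hdec : ∀ s ∈ Ico a b, ∃ d ≤ -κ,
      HasDerivWithinAt (fun t => lyap R.P (q t).1 (q t).2) d (Ici s) s :=
    fun s hs => D.decay s hs (h s hs)
  choose! d hd hd' using hdec
  have := image_le_of_deriv_right_le_deriv_boundary hV hd'
    (B := fun t => lyap R.P (q a).1 (q a).2 - κ * (t - a)) (B' := fun _ => -κ) (by simp)
    (by fun_prop)
    (fun s _ => by
      have := ((((hasDerivAt_id s).sub_const a).const_mul κ).const_sub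
        (lyap R.P (q a).1 (q a).2)).hasDerivWithinAt (s := Ici s)
      simpa using this)
    hd (right_mem_Icc.2 hab)
  exact this

/-- `S_v` is not closed, but a dissipating curve cannot leave it through its missing boundary. -/
theorem mem_Sv_right (D : DissipatesOn R ρ κ q a b) (hl : 0 < l) (hP : R.P.PosDef) (hκ : 0 < κ)
    (hδ : R.δ < ρ) (hr : alpha₂inv R.P (alpha₁ R.P R.rs) < R.δ) (hab : a < b)
    (h : ∀ s ∈ Ico a b, q s ∈ Sv k R.P R.δ) : q b ∈ Sv k R.P R.δ := by
  have hc := D.continuousOn hδ hab h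
  have hb : b ∈ Icc a b := right_mem_Icc.2 hab.le
  have hcl : b ∈ closure (Ico a b) := by rw [closure_Ico hab.ne]; exact hb
  have hpn : ContinuousOn (fun t => pairNorm (q t).1 (q t).2) (Icc a b) :=
    continuous_pairNorm.comp_continuousOn hc
  have hV : ContinuousOn (fun t => lyap R.P (q t).1 (q t).2) (Icc a b) :=
    continuous_lyap.comp_continuousOn hc
  have hVb : lyap R.P (q b).1 (q b).2 ≤ alpha₁ R.P R.δ :=
    ContinuousWithinAt.closure_le hcl ((hV b hb).mono Ico_subset_Icc_self)
      continuousWithinAt_const fun t ht => (h t ht).2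
  refine ⟨?_, hVb⟩
  change pairNorm (q b).1 (q b).2 < R.δ
  by_contra hcon
  -- close to `b` the curve is far from `S₂`, so that `V` has strictly decreased up to `b`
  have hev : ∀ᶠ t in 𝓝[Icc a b] b, alpha₂inv R.P (alpha₁ R.P R.rs) < pairNorm (q t).1 (q t).2 :=
    (hpn b hb).eventually_const_lt (hr.trans_le (not_lt.1 hcon))
  rw [eventually_nhdsWithin_iff, Metric.eventually_nhds_iff] at hev
  obtain ⟨η, hη, hη'⟩ := hev
  obtain ⟨a', ha', hab'⟩ := exists_between (max_lt hab (sub_lt_self b hη))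
  have haa' : a ≤ a' := (le_max_left _ _).trans ha'.le
  have hba' : b - η < a' := (le_max_right _ _).trans_lt ha'
  have hdec := (D.mono haa' le_rfl).lyap_le hδ hab'.le fun s hs => by
    refine ⟨h s ⟨haa'.trans hs.1, hs.2⟩, ?_⟩
    have := hη' (y := s) (by
      rw [Real.dist_eq, abs_sub_comm, abs_of_pos (sub_pos.2 hs.2)]; linarith [hs.1])
      ⟨haa'.trans hs.1, hs.2.le⟩
    exact not_lt.2 this.le
  have hVa' := (h a' ⟨haa', hab'⟩).2
  have hpos : 0 < κ * (b - a') := mul_pos hκ (sub_pos.2 hab')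
  exact hcon (pairNorm_lt_of_lyap_lt hl hP (by linarith))

/-- `S_v` is forward invariant. -/
theorem mem_Sv (D : DissipatesOn R ρ κ q a b) (hl : 0 < l) (hP : R.P.PosDef) (hκ : 0 < κ)
    (hδ : R.δ < ρ) (hrs : 0 < R.rs) (hsub : pairBall k l R.rs ⊆ Sv k R.P R.δ)
    (hr : alpha₂inv R.P (alpha₁ R.P R.rs) < R.δ) (ha : q a ∈ Sv k R.P R.δ) :
    ∀ s ∈ Icc a b, q s ∈ Sv k R.P R.δ := by
  by_contra! hcon
  obtain ⟨s₀, hs₀, hs₀'⟩ := hcon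
  -- `τ` is the time at which the curve is supposed to leave `S_v`
  set B := {s | s ∈ Icc a b ∧ q s ∉ Sv k R.P R.δ} with hB
  have hBne : B.Nonempty := ⟨s₀, hs₀, hs₀'⟩
  have hBbd : BddBelow B := ⟨a, fun s hs => hs.1.1⟩
  obtain ⟨τ, hτ⟩ : ∃ τ, τ = sInf B := ⟨_, rfl⟩
  have haτ : a ≤ τ := hτ ▸ le_csInf hBne fun s hs => hs.1.1
  have hτb : τ ≤ b := hτ ▸ (csInf_le hBbd hBne.some_mem).trans hBne.some_mem.1.2
  have hbefore : ∀ s ∈ Ico a τ, q s ∈ Sv k R.P R.δ := by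
    intro s hs
    by_contra hns
    have : sInf B ≤ s := csInf_le hBbd ⟨⟨hs.1, hs.2.le.trans hτb⟩, hns⟩
    rw [← hτ] at this
    exact absurd hs.2 (not_lt.2 this)
  have hτS : q τ ∈ Sv k R.P R.δ := by
    rcases haτ.eq_or_lt with rfl | hlt
    · exact ha
    · exact (D.mono le_rfl hτb).mem_Sv_right hl hP hκ hδ hr hlt hbefore
  have hτlt : τ < b := by
    rcases hτb.eq_or_lt with rfl | hlt
    · have h1 : s₀ = τ := le_antisymm hs₀.2 (hτ ▸ csInf_le hBbd ⟨hs₀, hs₀'⟩)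
      exact absurd (h1 ▸ hτS) hs₀'
    · exact hlt
  have hcont : ContinuousWithinAt q (Icc a b) τ :=
    D.cont τ ⟨haτ, hτb⟩ ((fst_lt_of_mem_Sv hτS).trans hδ)
  have hIoi : 𝓝[>] τ ≤ 𝓝[Icc a b] τ :=
    (nhdsWithin_Ioc_eq_nhdsGT hτlt).symm.le.trans
      (nhdsWithin_mono _ fun t ht => ⟨haτ.trans ht.1.le, ht.2⟩)
  have hpn : ContinuousWithinAt (fun t => pairNorm (q t).1 (q t).2) (Icc a b) τ :=
    continuous_pairNorm.continuousAt.comp_continuousWithinAt hcont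
  have hafter : ∀ᶠ t in 𝓝[>] τ, q t ∈ Sv k R.P R.δ := by
    by_cases hS₂ : q τ ∈ S₂ k R.P R.rs
    · filter_upwards [hIoi (hpn.eventually_lt_const hS₂)] with t ht
      exact hsub (lt_trans ht (alpha₂inv_alpha₁_lt hrs))
    · obtain ⟨d, hd, hd'⟩ := D.decay τ ⟨haτ, hτlt⟩ ⟨hτS, hS₂⟩
      filter_upwards [hIoi (hpn.eventually_lt_const hτS.1),
        eventually_lt_of_hasDerivWithinAt_neg hd' (by linarith)] with t ht ht'
      exact ⟨ht, ht'.le.trans hτS.2⟩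
  obtain ⟨u, hu, hu'⟩ := mem_nhdsGT_iff_exists_Ioo_subset.1 hafter
  obtain ⟨s, hs, hsu⟩ := exists_lt_of_csInf_lt hBne (hτ ▸ hu)
  have hτs : τ ≤ s := hτ ▸ csInf_le hBbd hs
  rcases hτs.eq_or_lt with rfl | hlt
  · exact hs.2 hτS
  · exact hs.2 (hu' ⟨hlt, hsu⟩)

/-- After a visit of `S₂` the curve stays in the ball of radius `r_s`. -/
theorem mem_pairBall_of_mem_S₂ (D : DissipatesOn R ρ κ q a b) (hl : 0 < l) (hP : R.P.PosDef)
    (hκ : 0 < κ) (hδ : R.δ < ρ) (hrs : 0 < R.rs) (hab : a ≤ b)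
    (hS : ∀ s ∈ Icc a b, q s ∈ Sv k R.P R.δ) (ha : q a ∈ S₂ k R.P R.rs) :
    q b ∈ pairBall k l R.rs := by
  have hr := alpha₂inv_alpha₁_lt (P := R.P) hrs
  by_cases hb : q b ∈ S₂ k R.P R.rs
  · exact pairBall_mono hr.le hb
  -- `τ` is the time of the last visit of the closure of `S₂`, where still `V ≤ α₁(r_s)`
  set A := {s | s ∈ Icc a b ∧ q s ∈ S₂ k R.P R.rs} with hA
  have hAne : A.Nonempty := ⟨a, left_mem_Icc.2 hab, ha⟩
  have hAbd : BddAbove A := ⟨b, fun s hs => hs.1.2⟩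
  obtain ⟨τ, hτ⟩ : ∃ τ, τ = sSup A := ⟨_, rfl⟩
  have haτ : a ≤ τ := hτ ▸ le_csSup hAbd ⟨left_mem_Icc.2 hab, ha⟩
  have hτb : τ ≤ b := hτ ▸ csSup_le hAne fun s hs => hs.1.2
  have hτI : τ ∈ Icc a b := ⟨haτ, hτb⟩
  have hpn : ContinuousWithinAt (fun t => pairNorm (q t).1 (q t).2) (Icc a b) τ :=
    continuous_pairNorm.continuousAt.comp_continuousWithinAt
      (D.cont τ hτI ((fst_lt_of_mem_Sv (hS τ hτI)).trans hδ))
  have hle : pairNorm (q τ).1 (q τ).2 ≤ alpha₂inv R.P (alpha₁ R.P R.rs) :=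
    ContinuousWithinAt.closure_le (hτ ▸ csSup_mem_closure hAne hAbd)
      (hpn.mono fun s hs => hs.1) continuousWithinAt_const fun t ht => le_of_lt ht.2
  rcases hτb.eq_or_lt with rfl | hlt
  · exact hle.trans_lt hr
  have hafter : ∀ s ∈ Ioc τ b, q s ∉ S₂ k R.P R.rs := by
    intro s hs hs'
    have : s ≤ sSup A := le_csSup hAbd ⟨⟨haτ.trans hs.1.le, hs.2⟩, hs'⟩
    rw [← hτ] at this
    exact absurd hs.1 (not_lt.2 this)
  have hτ' : q τ ∉ S₂ k R.P R.rs := by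
    intro hmem
    have hIoi : 𝓝[>] τ ≤ 𝓝[Icc a b] τ :=
      (nhdsWithin_Ioc_eq_nhdsGT hlt).symm.le.trans
        (nhdsWithin_mono _ fun t ht => ⟨haτ.trans ht.1.le, ht.2⟩)
    have hev : ∀ᶠ t in 𝓝[>] τ, pairNorm (q t).1 (q t).2 < alpha₂inv R.P (alpha₁ R.P R.rs) :=
      hIoi (hpn.eventually_lt_const hmem)
    obtain ⟨t, ht, htI⟩ := (hev.and (Ioc_mem_nhdsGT hlt)).exists
    exact hafter t htI ht
  have hdec := (D.mono haτ le_rfl).lyap_le hδ hτb fun s hs => by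
    refine ⟨hS s ⟨haτ.trans hs.1, hs.2.le⟩, ?_⟩
    rcases hs.1.eq_or_lt with rfl | hlt'
    · exact hτ'
    · exact hafter s ⟨hlt', hs.2.le⟩
  have hVτ := lyap_le_of_pairNorm_le hl hP hle
  have hpos : 0 < κ * (b - τ) := mul_pos hκ (sub_pos.2 hlt)
  exact pairNorm_lt_of_lyap_lt hl hP (by linarith)

/-- Since `0 ≤ V ≤ α₁(δ)` on `S_v`, the curve visits `S₂` within any time longer than
`α₁(δ) / κ`. -/
theorem exists_mem_S₂ (D : DissipatesOn R ρ κ q a b) (hδ : R.δ < ρ) (hab : a ≤ b)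
    (hS : ∀ s ∈ Icc a b, q s ∈ Sv k R.P R.δ) (hlong : alpha₁ R.P R.δ < κ * (b - a)) :
    ∃ s ∈ Icc a b, q s ∈ S₂ k R.P R.rs := by
  by_contra! hcon
  have hdec := D.lyap_le hδ hab fun s hs =>
    ⟨hS s (Ico_subset_Icc_self hs), hcon s (Ico_subset_Icc_self hs)⟩
  have h1 := (hS a (left_mem_Icc.2 hab)).2
  have h2 := lyap_nonneg (P := R.P) (q b).1 (q b).2
  linarith

end DissipatesOn

/-! ### Thresholds and the time between events -/

section Thresholds

variable {k l : ℕ}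

/-- One of `‖y‖` and `‖w‖` is at least `r / 2`. -/
theorem exists_pos_le_norm_add_rpow {r p : ℝ} (hr : 0 < r) (hp : 0 < p) :
    ∃ κ > 0, ∀ (y : Vec k) (w : Vec l), r ≤ pairNorm y w → κ ≤ ‖w‖ + ‖y‖ ^ p := by
  refine ⟨min (r / 2) ((r / 2) ^ p), by positivity, fun y w h => ?_⟩
  have h1 := h.trans (pairNorm_le_add y w)
  rcases le_total (r / 2) ‖w‖ with hw | hw
  · exact (min_le_left _ _).trans (hw.trans (le_add_of_nonneg_right (by positivity)))
  · refine (min_le_right _ _).trans (le_trans ?_ (le_add_of_nonneg_left (norm_nonneg w)))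
    gcongr
    linarith

theorem exists_thresholdBound {R : Rule k l} (hl : 0 < l) (hP : R.P.PosDef) (hsig : 0 < R.sig)
    (hp : 1 < R.p) (hrs : 0 < R.rs) : ∃ sl > 0, IsThresholdBound R sl := by
  obtain ⟨κ, hκ, h⟩ := exists_pos_le_norm_add_rpow (k := k) (l := l) (p := R.p + 1)
    (alpha₂inv_alpha₁_pos hl hP hrs) (by linarith)
  exact ⟨R.sig * κ, by positivity, fun q hq =>
    mul_le_mul_of_nonneg_left (h q.1 q.2 (not_lt.1 hq.2)) hsig.le⟩

end Thresholds

section Interevent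

variable {k l m : ℕ} {c : Loop k l m} {h : Vec k → Vec l}

theorem vco_add_app (y : Vec k) (z : Vec l) : c.vco y z + app c.E y = z := by simp [Loop.vco]

theorem wco_add (y : Vec k) (z : Vec l) : c.wco h y z + h y = c.vco y z := by simp [Loop.wco]

theorem pairNorm_neg {a b : ℕ} (y : Vec a) (w : Vec b) : pairNorm (-y) (-w) = pairNorm y w := by
  simp [pairNorm]

/-- The speed under sampled feedback, bounded in terms of the error alone. -/
theorem speed_le_of_growthConst {δ L : ℝ} (hL : 0 < L) (hg : IsGrowthConst c h δ L)
    {y y' : Vec k} {z z' : Vec l} (hq : (y, c.wco h y z) ∈ pairBall k l δ)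
    (hq' : (y', c.wco h y' z') ∈ pairBall k l δ) :
    pairNorm (c.fy y z (c.ctrl y' z'))
        (c.fz y z (c.ctrl y' z') - app c.E (c.fy y z (c.ctrl y' z')))
      ≤ L * pairNorm (y' - y) (c.vco y' z' - c.vco y z) + L * δ := by
  have h1 := hg y y' _ _ hq hq'
  simp only [wco_add, vco_add_app] at h1
  refine h1.trans ?_
  rw [← mul_add]
  refine mul_le_mul_of_nonneg_left ?_ hL.le
  have hq1 : pairNorm y (c.wco h y z) < δ := hq
  have h2 := pairNorm_sq y (c.wco h y z)
  have h3 := pairNorm_sq (y' - y) (c.vco y' z' - c.vco y z)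
  have h4 := pairNorm_nonneg y (c.wco h y z)
  have h5 := pairNorm_nonneg (y' - y) (c.vco y' z' - c.vco y z)
  refine Real.sqrt_le_iff.2 ⟨by linarith, ?_⟩
  nlinarith

theorem tau₃_pos {L sl δ : ℝ} (hL : 0 < L) (hsl : 0 < sl) (hδ : 0 < δ) : 0 < tau₃ L sl δ := by
  have : 0 < sl * L / (L * δ) := by positivity
  exact mul_pos (by positivity) (Real.log_pos (by linarith))

/-- The identification of a pair with its concatenation; `Prod` itself carries the maximum norm. -/
theorem exists_pairNorm_clm (d e : ℕ) :
    ∃ Φ : Vec d × Vec e →L[ℝ] WithLp 2 (Vec d × Vec e), ∀ x, ‖Φ x‖ = pairNorm x.1 x.2 := by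
  refine ⟨(WithLp.prodContinuousLinearEquiv 2 ℝ (Vec d) (Vec e)).symm.toContinuousLinearMap,
    fun x => ?_⟩
  rw [pairNorm_eq, ContinuousLinearEquiv.coe_coe, WithLp.prodContinuousLinearEquiv_symm_apply]

/-- Grönwall's inequality for the Euclidean norm of a pair of curves. The map `Φ` replaces the
maximum norm of the product by the Euclidean one. -/
theorem pairNorm_le_gronwallBound {X : Type*} [NormedAddCommGroup X] [NormedSpace ℝ X] {d e : ℕ}
    {p p' : ℝ → Vec d} {q q' : ℝ → Vec e} {a b L ε : ℝ}
    (Φ : Vec d × Vec e →L[ℝ] X) (hΦ : ∀ x, ‖Φ x‖ = pairNorm x.1 x.2)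
    (hab : a ≤ b) (hp : ContinuousOn p (Icc a b)) (hq : ContinuousOn q (Icc a b))
    (hp' : ∀ s ∈ Ico a b, HasDerivWithinAt p (p' s) (Ici s) s)
    (hq' : ∀ s ∈ Ico a b, HasDerivWithinAt q (q' s) (Ici s) s)
    (hbound : ∀ s ∈ Ico a b, pairNorm (p' s) (q' s) ≤ L * pairNorm (p s) (q s) + ε)
    (hpa : p a = 0) (hqa : q a = 0) :
    pairNorm (p b) (q b) ≤ gronwallBound 0 L ε (b - a) := by
  have hf : ContinuousOn (fun s => Φ (p s, q s)) (Icc a b) :=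
    Φ.continuous.comp_continuousOn (hp.prodMk hq)
  have hf' : ∀ s ∈ Ico a b, HasDerivWithinAt (fun s => Φ (p s, q s)) (Φ (p' s, q' s)) (Ici s) s :=
    fun s hs => Φ.hasFDerivAt.comp_hasDerivWithinAt s ((hp' s hs).prodMk (hq' s hs))
  have h0 : pairNorm (p a) (q a) ≤ 0 := by simp [hpa, hqa, pairNorm]
  have hgr := norm_le_gronwallBound_of_norm_deriv_right_le hf hf' (δ := 0) (K := L) (ε := ε)
    (by rw [hΦ]; exact h0) (fun s hs => by rw [hΦ, hΦ]; exact hbound s hs) b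
    (right_mem_Icc.2 hab)
  rwa [hΦ] at hgr

/-- Grönwall's inequality for the measurement error: while the input is held, the error needs at
least the time `τ₃` to grow from `0` to `sl`. -/
theorem tau₃_le_of_held {δ L sl a b : ℝ} (hL : 0 < L) (hg : IsGrowthConst c h δ L) (hδ : 0 < δ)
    (hsl : 0 < sl) {y : ℝ → Vec k} {z : ℝ → Vec l} (hab : a ≤ b)
    (hy : ContinuousOn y (Icc a b)) (hz : ContinuousOn z (Icc a b))
    (hyd : ∀ s ∈ Ico a b,
      HasDerivWithinAt y (c.fy (y s) (z s) (c.ctrl (y a) (z a))) (Ici s) s)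
    (hzd : ∀ s ∈ Ico a b,
      HasDerivWithinAt z (c.fz (y s) (z s) (c.ctrl (y a) (z a))) (Ici s) s)
    (hS : ∀ s ∈ Icc a b, (y s, c.wco h (y s) (z s)) ∈ pairBall k l δ)
    (hb : sl ≤ pairNorm (y a - y b) (c.vco (y a) (z a) - c.vco (y b) (z b))) :
    tau₃ L sl δ ≤ b - a := by
  obtain ⟨Φ, hΦ⟩ := exists_pairNorm_clm k l
  have hgr := pairNorm_le_gronwallBound Φ hΦ (p := fun s => y a - y s)
    (q := fun s => c.vco (y a) (z a) - c.vco (y s) (z s)) (L := L) (ε := L * δ) hab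
    (continuousOn_const.sub hy)
    (continuousOn_const.sub (hz.sub ((continuous_app c.E).comp_continuousOn hy)))
    (fun s hs => (hyd s hs).const_sub _)
    (fun s hs => HasDerivWithinAt.const_sub _ ((hzd s hs).sub
      ((appL c.E).hasFDerivAt.comp_hasDerivWithinAt s (hyd s hs))))
    (fun s hs => by
      rw [pairNorm_neg]
      exact speed_le_of_growthConst hL hg (hS s (Ico_subset_Icc_self hs))
        (hS a (left_mem_Icc.2 hab)))
    (sub_self _) (sub_self _)
  rw [gronwallBound_of_K_ne_0 hL.ne'] at hgr
  have h1 : sl ≤ δ * (Real.exp (L * (b - a)) - 1) := by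
    refine hb.trans (hgr.trans (le_of_eq ?_))
    field_simp
    ring
  have h2 : 1 + sl * L / (L * δ) ≤ Real.exp (L * (b - a)) := by
    have : sl * L / (L * δ) = sl / δ := by field_simp
    rw [this]
    have : sl / δ ≤ Real.exp (L * (b - a)) - 1 := by
      rw [div_le_iff₀ hδ]; linarith
    linarith
  have h3 : Real.log (1 + sl * L / (L * δ)) ≤ L * (b - a) := by
    rw [← Real.log_exp (L * (b - a))]
    exact Real.log_le_log (by positivity) h2
  rw [tau₃, one_div, inv_mul_le_iff₀ hL]
  exact h3

end Interevent

/-! ### Properties of all executions -/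

section Executions

variable {k l m : ℕ} {c : Loop k l m} {R : Rule k l} {ρ κ : ℝ}

/-- The sampled loop makes the Lyapunov function decrease at rate `κ` at every state in
`S_v \ S₂` at which the error is below the threshold of the triggering rule. -/
def SampledDecay (c : Loop k l m) (R : Rule k l) (κ : ℝ) : Prop :=
  ∀ (y : ℝ → Vec k) (z : ℝ → Vec l) (y' : Vec k) (z' : Vec l) (s : ℝ),
    (y s, c.wco R.h (y s) (z s)) ∈ R.active → (y', c.wco R.h y' z') ∈ Sv k R.P R.δ →
    HasDerivWithinAt y (c.fy (y s) (z s) (c.ctrl y' z')) (Ici s) s →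
    HasDerivWithinAt z (c.fz (y s) (z s) (c.ctrl y' z')) (Ici s) s →
    pairNorm (y' - y s) (c.vco y' z' - c.vco (y s) (z s))
      ≤ R.threshold (y s) (c.wco R.h (y s) (z s)) →
    ∃ d ≤ -κ, HasDerivWithinAt (fun t => lyap R.P (y t) (c.wco R.h (y t) (z t))) d (Ici s) s

/-- The conditions on the parameters of the rule and on the vector fields under which the
event-triggered loop is analysed: `ρ` is the radius of the domain of the center manifold, and `κ`
the decay rate of `V` on `S_v \ S₂`. -/
structure Standing (c : Loop k l m) (R : Rule k l) (ρ κ : ℝ) : Prop where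
  decay : SampledDecay c R κ
  manifold : c.IsCenterManifold ρ R.h
  h_le : ∀ y, ‖y‖ < R.δ → ‖R.h y‖ ≤ ‖y‖
  l_pos : 0 < l
  posDef : R.P.PosDef
  κ_pos : 0 < κ
  δ_pos : 0 < R.δ
  δ_lt : R.δ < ρ
  p_gt : 1 < R.p
  sig_pos : 0 < R.sig
  rs_pos : 0 < R.rs
  sub : pairBall k l R.rs ⊆ Sv k R.P R.δ
  r₁_lt : alpha₂inv R.P (alpha₁ R.P R.rs) < R.δ

theorem continuousWithinAt_state (hh : c.IsCenterManifold ρ R.h) {y : ℝ → Vec k} {z : ℝ → Vec l}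
    {S : Set ℝ} {s : ℝ} (hy : ContinuousWithinAt y S s) (hz : ContinuousWithinAt z S s)
    (hs : ‖y s‖ < ρ) : ContinuousWithinAt (fun t => (y t, c.wco R.h (y t) (z t))) S s :=
  hy.prodMk ((hz.sub ((continuous_app c.E).continuousAt.comp_continuousWithinAt hy)).sub
    ((hh.differentiableAt hs).continuousAt.comp_continuousWithinAt hy))

theorem IsFirst.eq_top_or {A : Set ℝ} {τ : EReal} (h : IsFirst A τ) :
    τ = ⊤ ∨ ∃ s : ℝ, τ = (s : EReal) := by
  rcases h with ⟨s, hs, -⟩ | ⟨hs, -⟩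
  · exact Or.inr ⟨s, hs⟩
  · exact Or.inl hs

theorem IsFirst.isLeast {A : Set ℝ} {s : ℝ} (h : IsFirst A (s : EReal)) : IsLeast A s := by
  rcases h with ⟨s', hs, h⟩ | ⟨hs, -⟩
  · rwa [EReal.coe_eq_coe_iff.1 hs]
  · exact absurd hs (EReal.coe_ne_top s)

theorem IsFirst.notMem {A : Set ℝ} {τ : EReal} (h : IsFirst A τ) {s : ℝ} (hs : (s : EReal) < τ) :
    s ∉ A := by
  rcases h with ⟨s', rfl, h⟩ | ⟨-, h⟩
  · exact fun hmem => absurd (h.2 hmem) (not_le.2 (EReal.coe_lt_coe_iff.1 hs))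
  · simp [h]

namespace IsExecution

variable {t₀ : ℝ} {T : EReal} {y : ℝ → Vec k} {z : ℝ → Vec l} {u : ℝ → Vec m} {t : ℕ → EReal}

theorem eq_top_or (hx : IsExecution c R t₀ T y z u t) (i : ℕ) :
    t i = ⊤ ∨ ∃ a : ℝ, t i = (a : EReal) := by
  induction i with
  | zero => exact Or.inr ⟨t₀, hx.start⟩
  | succ i ih =>
    rcases Nat.eq_zero_or_pos i with rfl | hi
    · exact hx.first_event.eq_top_or
    · rcases ih with h | ⟨a, h⟩
      · exact Or.inl (hx.no_event i hi h)
      · exact (hx.next_event i hi a h).eq_top_or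

theorem event_mem (hx : IsExecution c R t₀ T y z u t) {i : ℕ} (hi : 1 ≤ i) {a : ℝ}
    (ha : t i = (a : EReal)) :
    t₀ ≤ a ∧ (a : EReal) < T ∧ (y a, c.wco R.h (y a) (z a)) ∈ R.active := by
  induction i, hi using Nat.le_induction generalizing a with
  | base => exact (ha ▸ hx.first_event).isLeast.1
  | succ i hi ih =>
    rcases hx.eq_top_or i with h | ⟨a', h⟩
    · exact absurd (ha.symm.trans (hx.no_event i hi h)) (EReal.coe_ne_top a)
    · have hm := (ha ▸ hx.next_event i hi a' h).isLeast.1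
      exact ⟨(ih h).1.trans hm.1, hm.2.1, hm.2.2.2⟩

/-- At a state in `S_v \ S₂` the input is a sampled one, and the error is below the threshold. -/
theorem exists_sample (hx : IsExecution c R t₀ T y z u t) {s : ℝ} (hs : t₀ ≤ s)
    (hsT : (s : EReal) < T) (hact : (y s, c.wco R.h (y s) (z s)) ∈ R.active) :
    ∃ a : ℝ, (y a, c.wco R.h (y a) (z a)) ∈ R.active ∧ u s = c.ctrl (y a) (z a) ∧
      pairNorm (y a - y s) (c.vco (y a) (z a) - c.vco (y s) (z s))
        < R.threshold (y s) (c.wco R.h (y s) (z s)) := by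
  classical
  have hcov := hx.covered s hs hsT
  have hi := Nat.find_spec hcov
  have hmin : ∀ j < Nat.find hcov, ¬ (s : EReal) < t (j + 1) := fun j hj => Nat.find_min hcov hj
  generalize Nat.find hcov = i at hi hmin
  rcases Nat.eq_zero_or_pos i with rfl | hi0
  · exact absurd ⟨hs, hsT, hact⟩ (hx.first_event.notMem hi)
  · obtain ⟨j, rfl⟩ : ∃ j, i = j + 1 := ⟨i - 1, by omega⟩
    have hle : t (j + 1) ≤ s := not_lt.1 (hmin j (by omega))
    rcases hx.eq_top_or (j + 1) with h | ⟨a, ha⟩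
    · rw [h] at hle
      exact absurd (top_le_iff.1 hle) (EReal.coe_ne_top s)
    · rw [ha] at hle
      have has : a ≤ s := EReal.coe_le_coe_iff.1 hle
      refine ⟨a, (hx.event_mem hi0 ha).2.2, hx.input_held _ hi0 a ha s has hsT hi, ?_⟩
      by_contra hcon
      exact (hx.next_event _ hi0 a ha).notMem hi ⟨has, hsT, not_lt.1 hcon, hact⟩

theorem dissipatesOn (hx : IsExecution c R t₀ T y z u t) (hdec : SampledDecay c R κ)
    (hh : c.IsCenterManifold ρ R.h) {b : ℝ} (hb : (b : EReal) < T) :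
    DissipatesOn R ρ κ (fun s => (y s, c.wco R.h (y s) (z s))) t₀ b := by
  have hsub : Icc t₀ b ⊆ {s : ℝ | t₀ ≤ s ∧ (s : EReal) < T} := fun s hs =>
    ⟨hs.1, (EReal.coe_le_coe_iff.2 hs.2).trans_lt hb⟩
  refine ⟨hx.y_cont.mono hsub, fun s hs hρ => continuousWithinAt_state hh
    ((hx.y_cont.mono hsub) s hs) ((hx.z_cont.mono hsub) s hs) hρ, fun s hs hact => ?_⟩
  have hs' := hsub (Ico_subset_Icc_self hs)
  obtain ⟨a, ha, hu, he⟩ := hx.exists_sample hs'.1 hs'.2 hact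
  exact hdec y z (y a) (z a) s hact ha.1 (hu ▸ hx.y_ode s hs'.1 hs'.2)
    (hu ▸ hx.z_ode s hs'.1 hs'.2) he.le

/-- `S_v` is forward invariant under the event-triggered closed loop. -/
theorem mem_Sv (hx : IsExecution c R t₀ T y z u t) (S : Standing c R ρ κ)
    (h0 : (y t₀, c.wco R.h (y t₀) (z t₀)) ∈ Sv k R.P R.δ) {s : ℝ} (hs : t₀ ≤ s)
    (hsT : (s : EReal) < T) : (y s, c.wco R.h (y s) (z s)) ∈ Sv k R.P R.δ :=
  (hx.dissipatesOn S.decay S.manifold hsT).mem_Sv S.l_pos S.posDef S.κ_pos S.δ_lt S.rs_pos S.sub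
    S.r₁_lt h0 s ⟨hs, le_rfl⟩

/-- Ultimate boundedness: `V ≤ α₁(δ)` on `S_v` and `V` decreases at rate `κ` outside `S₂`, so that
`S₂` is visited within time `α₁(δ) / κ + 1`; the extra `1` makes the time strictly longer than
`α₁(δ) / κ`. -/
theorem mem_pairBall (hx : IsExecution c R t₀ T y z u t) (S : Standing c R ρ κ)
    (h0 : (y t₀, c.wco R.h (y t₀) (z t₀)) ∈ Sv k R.P R.δ) {s : ℝ}
    (hs : t₀ + (alpha₁ R.P R.δ / κ + 1) ≤ s) (hsT : (s : EReal) < T) :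
    (y s, c.wco R.h (y s) (z s)) ∈ pairBall k l R.rs := by
  have hα : 0 < alpha₁ R.P R.δ := mul_pos (alpha₁_coeff_pos S.l_pos S.posDef) S.δ_pos
  have hκ := S.κ_pos
  have hts : t₀ ≤ s := by
    have : 0 < alpha₁ R.P R.δ / κ := by positivity
    linarith
  have D := hx.dissipatesOn S.decay S.manifold hsT
  have hS := D.mem_Sv S.l_pos S.posDef hκ S.δ_lt S.rs_pos S.sub S.r₁_lt h0
  obtain ⟨a, ha, ha'⟩ := D.exists_mem_S₂ S.δ_lt hts hS (by
    rw [← div_lt_iff₀' hκ]; linarith)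
  exact (D.mono ha.1 le_rfl).mem_pairBall_of_mem_S₂ S.l_pos S.posDef hκ S.δ_lt S.rs_pos ha.2
    (fun r hr' => hS r ⟨ha.1.trans hr'.1, hr'.2⟩) ha'

/-- The error vanishes at `a` and is at least the threshold, hence at least `sl`, at `b`. -/
theorem tau₃_le (hx : IsExecution c R t₀ T y z u t) {L sl : ℝ} (hL : 0 < L)
    (hg : IsGrowthConst c R.h R.δ L) (hδ : 0 < R.δ) (hsl : 0 < sl) (hb : IsThresholdBound R sl)
    (hS : ∀ s, t₀ ≤ s → (s : EReal) < T → (y s, c.wco R.h (y s) (z s)) ∈ Sv k R.P R.δ)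
    {i : ℕ} (hi : 1 ≤ i) {a b : ℝ} (ha : t i = (a : EReal)) (hb' : t (i + 1) = (b : EReal)) :
    tau₃ L sl R.δ ≤ b - a := by
  obtain ⟨hta, -, -⟩ := hx.event_mem hi ha
  have hnext := hx.next_event i hi a ha
  rw [hb'] at hnext
  obtain ⟨hab, hbT, hthr, hact⟩ := hnext.isLeast.1
  have hsub : Icc a b ⊆ {s : ℝ | t₀ ≤ s ∧ (s : EReal) < T} := fun s hs =>
    ⟨hta.trans hs.1, (EReal.coe_le_coe_iff.2 hs.2).trans_lt hbT⟩
  have hu : ∀ s ∈ Ico a b, u s = c.ctrl (y a) (z a) := fun s hs =>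
    hx.input_held i hi a ha s hs.1 (hsub (Ico_subset_Icc_self hs)).2
      (by rw [hb']; exact EReal.coe_lt_coe_iff.2 hs.2)
  refine tau₃_le_of_held hL hg hδ hsl hab (hx.y_cont.mono hsub) (hx.z_cont.mono hsub)
    (fun s hs => ?_) (fun s hs => ?_) (fun s hs => (hS s (hsub hs).1 (hsub hs).2).1)
    ((hb _ hact).trans hthr)
  · rw [← hu s hs]
    exact hx.y_ode s (hsub (Ico_subset_Icc_self hs)).1 (hsub (Ico_subset_Icc_self hs)).2
  · rw [← hu s hs]
    exact hx.z_ode s (hsub (Ico_subset_Icc_self hs)).1 (hsub (Ico_subset_Icc_self hs)).2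

end IsExecution

end Executions

/-! ### Solutions between two events -/

section Stage

variable {k l m : ℕ}

/-- The state `(y, w)` that belongs to `x = (y, z)`. -/
noncomputable def Loop.state (c : Loop k l m) (h : Vec k → Vec l) (x : Vec k × Vec l) :
    Vec k × Vec l := (x.1, c.wco h x.1 x.2)

/-- The vector field of the plant under the constant input `u`. -/
noncomputable def Loop.field (c : Loop k l m) (u : Vec m) (x : Vec k × Vec l) : Vec k × Vec l :=
  (c.fy x.1 x.2 u, c.fz x.1 x.2 u)

theorem Loop.contDiff_field {c : Loop k l m} (hc : c.Admissible) (u : Vec m) :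
    ContDiff ℝ 1 (c.field u) := by
  have harg : ContDiff ℝ 1 (fun x : Vec k × Vec l => (x.1, x.2, u)) :=
    contDiff_fst.prodMk (contDiff_snd.prodMk contDiff_const)
  have h1 := (hc.g₁_smooth.of_le one_le_two).comp harg
  have h2 := (hc.g₂_smooth.of_le one_le_two).comp harg
  exact (((appL c.A₁).contDiff.comp contDiff_fst).add h1).prodMk
    ((((appL c.A₂).contDiff.comp contDiff_snd).add contDiff_const).add h2)

/-- The times from `a` on at which the curve `p` triggers an event. If `held` holds then `p` runs
under the input sampled at time `a` and the error has to reach the threshold; otherwise entering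
`S_v \ S₂` suffices, which is the rule for the first event. -/
def eventSet (c : Loop k l m) (R : Rule k l) (held : Prop) (a : ℝ) (p : ℝ → Vec k × Vec l) :
    Set ℝ :=
  {s | a ≤ s ∧ (held → R.threshold (p s).1 (c.wco R.h (p s).1 (p s).2) ≤
      pairNorm ((p a).1 - (p s).1) (c.vco (p a).1 (p a).2 - c.vco (p s).1 (p s).2)) ∧
    c.state R.h (p s) ∈ R.active}

/-- A curve that runs from time `a` on under the constant input `u` as long as its state is in
`S_v`; if `held` holds, the input is the one sampled at time `a`. -/
structure IsStage (c : Loop k l m) (R : Rule k l) (held : Prop) (u : Vec m) (a : ℝ)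
    (p : ℝ → Vec k × Vec l) : Prop where
  cont : Continuous p
  ode : ∀ s, c.state R.h (p s) ∈ Sv k R.P R.δ → HasDerivAt p (c.field u (p s)) s
  input : held → u = c.ctrl (p a).1 (p a).2
  start : c.state R.h (p a) ∈ Sv k R.P R.δ

variable {c : Loop k l m} {R : Rule k l} {ρ κ : ℝ}

theorem continuous_threshold (hp : 0 ≤ R.p + 1) :
    Continuous fun q : Vec k × Vec l => R.threshold q.1 q.2 := by
  have hrpow : Continuous fun q : Vec k × Vec l => ‖q.1‖ ^ (R.p + 1) :=
    continuous_fst.norm.rpow_const fun _ => Or.inr hp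
  exact continuous_const.mul (continuous_snd.norm.add hrpow)

/-- The radius `(2 + ‖E‖) δ` bounds `z = w + h(y) + E y` while the state is in `S_v`. -/
theorem exists_isStage (hc : c.Admissible) (S : Standing c R ρ κ) {held : Prop} {u : Vec m} {a : ℝ}
    {x : Vec k × Vec l} (hu : held → u = c.ctrl x.1 x.2)
    (hx : c.state R.h x ∈ Sv k R.P R.δ) : ∃ p, p a = x ∧ IsStage c R held u a p := by
  obtain ⟨φ, h0, hφ, hode⟩ := exists_global_curve (Loop.contDiff_field hc u)
    ((2 + ‖appL c.E‖) * R.δ) x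
  have h0' : φ (a - a) = x := by rw [sub_self, h0]
  refine ⟨fun s => φ (s - a), h0', hφ.comp (continuous_id.sub continuous_const), fun s hs => ?_,
    fun h => by simpa only [h0'] using hu h, by simpa only [h0'] using hx⟩
  have hy : ‖(φ (s - a)).1‖ < R.δ := (norm_fst_le_pairNorm _ _).trans_lt hs.1
  have hw : ‖c.wco R.h (φ (s - a)).1 (φ (s - a)).2‖ < R.δ :=
    (norm_snd_le_pairNorm _ _).trans_lt hs.1
  have hz : ‖(φ (s - a)).2‖ < (2 + ‖appL c.E‖) * R.δ := by
    have h1 : (φ (s - a)).2 = c.wco R.h (φ (s - a)).1 (φ (s - a)).2 + R.h (φ (s - a)).1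
        + app c.E (φ (s - a)).1 := by rw [wco_add, vco_add_app]
    rw [h1]
    refine norm_add₃_le.trans_lt ?_
    have h2 := S.h_le _ hy
    have h3 := norm_app_le c.E (φ (s - a)).1
    have h4 : ‖appL c.E‖ * ‖(φ (s - a)).1‖ ≤ ‖appL c.E‖ * R.δ := by gcongr
    have := S.δ_pos
    linarith
  have hnorm : ‖φ (s - a)‖ < (2 + ‖appL c.E‖) * R.δ := by
    rw [Prod.norm_def, max_lt_iff]
    refine ⟨hy.trans_le ?_, hz⟩
    have := mul_nonneg (norm_nonneg (appL c.E)) S.δ_pos.le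
    have := S.δ_pos
    linarith
  exact (hode _ hnorm).comp_sub_const s a

namespace IsStage

variable {held : Prop} {u : Vec m} {a : ℝ} {p : ℝ → Vec k × Vec l}

/-- Before the next event a stage cannot leave `S_v`. -/
theorem mem_Sv (st : IsStage c R held u a p) (S : Standing c R ρ κ) {b : ℝ}
    (hno : ∀ s ∈ Ico a b, s ∉ eventSet c R held a p) :
    ∀ s ∈ Icc a b, c.state R.h (p s) ∈ Sv k R.P R.δ := by
  have D : DissipatesOn R ρ κ (fun s => c.state R.h (p s)) a b := by
    refine ⟨st.cont.fst.continuousOn, fun s _ hρ => continuousWithinAt_state S.manifold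
      st.cont.fst.continuousWithinAt st.cont.snd.continuousWithinAt hρ, fun s hs hact => ?_⟩
    by_cases hh : held
    · have hode := (st.ode s hact.1).hasDerivWithinAt (s := Ici s)
      rw [st.input hh] at hode
      refine S.decay (fun t => (p t).1) (fun t => (p t).2) (p a).1 (p a).2 s hact st.start
        hode.fst hode.snd (le_of_lt ?_)
      by_contra hcon
      exact hno s hs ⟨hs.1, fun _ => not_lt.1 hcon, hact⟩
    · exact absurd ⟨hs.1, fun h => absurd h hh, hact⟩ (hno s hs)
  exact D.mem_Sv S.l_pos S.posDef S.κ_pos S.δ_lt S.rs_pos S.sub S.r₁_lt st.start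

/-- The next event time exists as a minimum. -/
theorem isLeast_sInf (st : IsStage c R held u a p) (S : Standing c R ρ κ)
    (hne : (eventSet c R held a p).Nonempty) :
    IsLeast (eventSet c R held a p) (sInf (eventSet c R held a p)) := by
  have hbd : BddBelow (eventSet c R held a p) := ⟨a, fun s hs => hs.1⟩
  refine ⟨?_, fun s hs => csInf_le hbd hs⟩
  have hcl := csInf_mem_closure hne hbd
  have hab : a ≤ sInf (eventSet c R held a p) := le_csInf hne fun s hs => hs.1
  have hSv := st.mem_Sv S (b := sInf (eventSet c R held a p))
    (fun s hs hmem => absurd (csInf_le hbd hmem) (not_le.2 hs.2)) _ ⟨hab, le_rfl⟩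
  generalize sInf (eventSet c R held a p) = b at hcl hab hSv
  have hq : ContinuousWithinAt (fun t => c.state R.h (p t)) (eventSet c R held a p) b :=
    continuousWithinAt_state S.manifold st.cont.fst.continuousWithinAt
      st.cont.snd.continuousWithinAt ((fst_lt_of_mem_Sv hSv).trans S.δ_lt)
  refine ⟨hab, fun hh => ?_, hSv, ?_⟩
  · have hthr : ContinuousWithinAt (fun s => R.threshold (c.state R.h (p s)).1
        (c.state R.h (p s)).2) (eventSet c R held a p) b :=
      (continuous_threshold (by linarith [S.p_gt])).continuousAt.comp_continuousWithinAt
        (f := fun s => c.state R.h (p s)) hq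
    have hv : Continuous fun s => c.vco (p s).1 (p s).2 :=
      st.cont.snd.sub ((continuous_app c.E).comp st.cont.fst)
    have herr : Continuous fun s =>
        pairNorm ((p a).1 - (p s).1) (c.vco (p a).1 (p a).2 - c.vco (p s).1 (p s).2) :=
      continuous_pairNorm.comp (f := fun s =>
        ((p a).1 - (p s).1, c.vco (p a).1 (p a).2 - c.vco (p s).1 (p s).2))
        ((continuous_const.sub st.cont.fst).prodMk (continuous_const.sub hv))
    exact ContinuousWithinAt.closure_le hcl hthr herr.continuousWithinAt fun s hs => hs.2.1 hh
  · exact not_lt.2 (ContinuousWithinAt.closure_le hcl continuousWithinAt_const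
      (continuous_pairNorm.continuousAt.comp_continuousWithinAt
        (f := fun s => c.state R.h (p s)) hq)
      fun s hs => not_lt.1 hs.2.2.2)

theorem tau₃_le (st : IsStage c R held u a p) (S : Standing c R ρ κ) (hh : held) {L sl : ℝ}
    (hL : 0 < L) (hg : IsGrowthConst c R.h R.δ L) (hsl : 0 < sl) (hsb : IsThresholdBound R sl)
    {b : ℝ} (hb : IsLeast (eventSet c R held a p) b) : tau₃ L sl R.δ ≤ b - a := by
  have hSv := st.mem_Sv S (b := b) (fun s hs hmem => absurd (hb.2 hmem) (not_le.2 hs.2))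
  have hode : ∀ s ∈ Ico a b,
      HasDerivWithinAt p (c.field (c.ctrl (p a).1 (p a).2) (p s)) (Ici s) s := fun s hs => by
    rw [← st.input hh]
    exact (st.ode s (hSv s (Ico_subset_Icc_self hs))).hasDerivWithinAt
  exact tau₃_le_of_held hL hg S.δ_pos hsl hb.1.1 st.cont.fst.continuousOn st.cont.snd.continuousOn
    (fun s hs => (hode s hs).fst) (fun s hs => (hode s hs).snd) (fun s hs => (hSv s hs).1)
    ((hsb _ hb.1.2.2).trans (hb.1.2.1 hh))

end IsStage

end Stage

/-! ### Gluing the stages -/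

section EventSequence

variable {k l m : ℕ}

/-- The input of the `i`-th stage, which starts at `x`: zero before the first event
(`i = 0`), and the sampled feedback afterwards. -/
noncomputable def Loop.stageInput (c : Loop k l m) (i : ℕ) (x : Vec k × Vec l) : Vec m :=
  if 1 ≤ i then c.ctrl x.1 x.2 else 0

open Classical in
/-- The event times and the states at the events, if the `i`-th stage that starts at time `a` in
`x` is the curve `Φ i a x`. Once the time is `⊤` the recorded state is meaningless. -/
noncomputable def eventNode (c : Loop k l m) (R : Rule k l)
    (Φ : ℕ → ℝ → Vec k × Vec l → ℝ → Vec k × Vec l) (t₀ : ℝ) (x₀ : Vec k × Vec l) :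
    ℕ → EReal × (Vec k × Vec l)
  | 0 => (t₀, x₀)
  | i + 1 =>
    let n := eventNode c R Φ t₀ x₀ i
    let A := eventSet c R (1 ≤ i) n.1.toReal (Φ i n.1.toReal n.2)
    if n.1 ≠ ⊤ ∧ A.Nonempty then ((sInf A : ℝ), Φ i n.1.toReal n.2 (sInf A)) else (⊤, n.2)

/-- Event times `t i`, states `x i` at these times and stages `p i` between them. -/
structure IsEventSequence (c : Loop k l m) (R : Rule k l) (t₀ : ℝ) (x₀ : Vec k × Vec l)
    (t : ℕ → EReal) (x : ℕ → Vec k × Vec l) (p : ℕ → ℝ → Vec k × Vec l) : Prop where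
  time_zero : t 0 = t₀
  state_zero : x 0 = x₀
  top : ∀ i, t i = ⊤ → t (i + 1) = ⊤
  start : ∀ i (a : ℝ), t i = a → p i a = x i
  stage : ∀ i (a : ℝ), t i = a → IsStage c R (1 ≤ i) (c.stageInput i (x i)) a (p i)
  first : ∀ i (a : ℝ), t i = a → IsFirst (eventSet c R (1 ≤ i) a (p i)) (t (i + 1))
  next : ∀ i (a b : ℝ), t i = a → t (i + 1) = b → x (i + 1) = p i b

variable {c : Loop k l m} {R : Rule k l} {ρ κ : ℝ}

theorem exists_isEventSequence (hc : c.Admissible) (S : Standing c R ρ κ) (t₀ : ℝ)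
    {x₀ : Vec k × Vec l} (hx₀ : c.state R.h x₀ ∈ Sv k R.P R.δ) :
    ∃ t x p, IsEventSequence c R t₀ x₀ t x p := by
  have hst : ∀ (i : ℕ) (a : ℝ) (x : Vec k × Vec l), ∃ p : ℝ → Vec k × Vec l,
      c.state R.h x ∈ Sv k R.P R.δ → p a = x ∧ IsStage c R (1 ≤ i) (c.stageInput i x) a p := by
    intro i a x
    by_cases hx : c.state R.h x ∈ Sv k R.P R.δ
    · obtain ⟨p, hp⟩ := exists_isStage hc S (held := 1 ≤ i) (u := c.stageInput i x) (a := a)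
        (fun h => by rw [Loop.stageInput, if_pos h]) hx
      exact ⟨p, fun _ => hp⟩
    -- stages are never started outside of `S_v`
    · exact ⟨fun _ => x, fun h => absurd h hx⟩
  choose Φ hΦ using hst
  obtain ⟨N, hN⟩ : ∃ N, N = eventNode c R Φ t₀ x₀ := ⟨_, rfl⟩
  have hN0 : N 0 = (↑t₀, x₀) := by rw [hN]; rfl
  have hsucc_top : ∀ i, (N i).1 = ⊤ → (N (i + 1)).1 = ⊤ := by
    intro i hi
    rw [hN] at hi ⊢
    simp [eventNode, hi]
  have hsucc : ∀ i (a : ℝ), (N i).1 = a →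
      ((eventSet c R (1 ≤ i) a (Φ i a (N i).2)).Nonempty ∧
        N (i + 1) = (((sInf (eventSet c R (1 ≤ i) a (Φ i a (N i).2)) : ℝ) : EReal),
          Φ i a (N i).2 (sInf (eventSet c R (1 ≤ i) a (Φ i a (N i).2))))) ∨
      (eventSet c R (1 ≤ i) a (Φ i a (N i).2) = ∅ ∧ (N (i + 1)).1 = ⊤) := by
    intro i a hi
    rw [hN] at hi ⊢
    by_cases hne : (eventSet c R (1 ≤ i) a (Φ i a (eventNode c R Φ t₀ x₀ i).2)).Nonempty
    · exact Or.inl ⟨hne, by simp [eventNode, hi, hne]⟩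
    · exact Or.inr ⟨not_nonempty_iff_eq_empty.1 hne, by simp [eventNode, hi, hne]⟩
  have hinv : ∀ i, (N i).1 = ⊤ ∨ ∃ a : ℝ, (N i).1 = a ∧ c.state R.h (N i).2 ∈ Sv k R.P R.δ := by
    intro i
    induction i with
    | zero => exact Or.inr ⟨t₀, by rw [hN0], by rw [hN0]; exact hx₀⟩
    | succ i ih =>
      rcases ih with h | ⟨a, ha, hS⟩
      · exact Or.inl (hsucc_top i h)
      · rcases hsucc i a ha with ⟨hne, h⟩ | ⟨-, h⟩
        · refine Or.inr ⟨_, by rw [h], ?_⟩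
          rw [h]
          exact (((hΦ i a _ hS).2.isLeast_sInf S hne).1.2.2).1
        · exact Or.inl h
  have hSv : ∀ i (a : ℝ), (N i).1 = a → c.state R.h (N i).2 ∈ Sv k R.P R.δ := by
    intro i a ha
    rcases hinv i with h | ⟨-, -, h⟩
    · exact absurd (ha.symm.trans h) (EReal.coe_ne_top a)
    · exact h
  refine ⟨fun i => (N i).1, fun i => (N i).2, fun i => Φ i (N i).1.toReal (N i).2,
    by simp [hN0], by simp [hN0], hsucc_top, ?_, ?_, ?_, ?_⟩
  · intro i a ha
    simp only [ha, EReal.toReal_coe]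
    exact (hΦ i a _ (hSv i a ha)).1
  · intro i a ha
    simp only [ha, EReal.toReal_coe]
    exact (hΦ i a _ (hSv i a ha)).2
  · intro i a ha
    simp only [ha, EReal.toReal_coe]
    rcases hsucc i a ha with ⟨hne, h⟩ | ⟨hemp, h⟩
    · exact Or.inl ⟨_, by rw [h], (hΦ i a _ (hSv i a ha)).2.isLeast_sInf S hne⟩
    · exact Or.inr ⟨h, hemp⟩
  · intro i a b ha hb
    simp only [ha, EReal.toReal_coe]
    rcases hsucc i a ha with ⟨hne, h⟩ | ⟨-, h⟩
    · simp only [h] at hb ⊢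
      rw [← EReal.coe_eq_coe_iff.1 hb]
    · exact absurd (hb.symm.trans h) (EReal.coe_ne_top b)

/-- The first time of a set of times depends on the set only up to that time. -/
theorem IsFirst.congr {A A' : Set ℝ} {τ : EReal} {a : ℝ} (h : IsFirst A τ) (hA' : ∀ s ∈ A', a ≤ s)
    (hA : ∀ s ∈ A, a ≤ s) (hiff : ∀ s, a ≤ s → (s : EReal) ≤ τ → (s ∈ A' ↔ s ∈ A)) :
    IsFirst A' τ := by
  rcases h with ⟨b, rfl, hb⟩ | ⟨rfl, hemp⟩
  · refine Or.inl ⟨b, rfl, (hiff b (hA b hb.1) le_rfl).2 hb.1, fun s hs => ?_⟩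
    by_contra hlt
    have hlt' := not_le.1 hlt
    exact hlt (hb.2 ((hiff s (hA' s hs) (EReal.coe_le_coe_iff.2 hlt'.le)).1 hs))
  · refine Or.inr ⟨rfl, eq_empty_of_forall_notMem fun s hs => ?_⟩
    have := (hiff s (hA' s hs) le_top).1 hs
    simp [hemp] at this

/-- The index of the stage that is active at time `s`, which is meaningful if some event
time is later than `s`. -/
noncomputable def stageIndex (t : ℕ → EReal) (s : ℝ) : ℕ := sInf {i | (s : EReal) < t (i + 1)}

namespace IsEventSequence

variable {t₀ : ℝ} {x₀ : Vec k × Vec l} {t : ℕ → EReal} {x : ℕ → Vec k × Vec l}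
  {p : ℕ → ℝ → Vec k × Vec l}

theorem eq_top_or (es : IsEventSequence c R t₀ x₀ t x p) (i : ℕ) :
    t i = ⊤ ∨ ∃ a : ℝ, t i = a := by
  induction i with
  | zero => exact Or.inr ⟨t₀, es.time_zero⟩
  | succ i ih =>
    rcases ih with h | ⟨a, h⟩
    · exact Or.inl (es.top i h)
    · exact (es.first i a h).eq_top_or

theorem le_succ (es : IsEventSequence c R t₀ x₀ t x p) (i : ℕ) : t i ≤ t (i + 1) := by
  rcases es.eq_top_or i with h | ⟨a, ha⟩
  · rw [es.top i h]; exact le_top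
  · rcases es.eq_top_or (i + 1) with h | ⟨b, hb⟩
    · rw [h]; exact le_top
    · rw [ha, hb, EReal.coe_le_coe_iff]
      exact (hb ▸ es.first i a ha).isLeast.1.1

theorem monotone (es : IsEventSequence c R t₀ x₀ t x p) : Monotone t :=
  monotone_nat_of_le_succ es.le_succ

theorem piece_mem_Sv (es : IsEventSequence c R t₀ x₀ t x p) (S : Standing c R ρ κ) {i : ℕ}
    {a s : ℝ} (ha : t i = a) (has : a ≤ s) (hs : (s : EReal) ≤ t (i + 1)) :
    c.state R.h (p i s) ∈ Sv k R.P R.δ :=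
  (es.stage i a ha).mem_Sv S (b := s) (fun _ hr => (es.first i a ha).notMem
    ((EReal.coe_lt_coe_iff.2 hr.2).trans_le hs)) s ⟨has, le_rfl⟩

/-- Event times do not accumulate. -/
theorem exists_gap (es : IsEventSequence c R t₀ x₀ t x p) (S : Standing c R ρ κ) {L : ℝ}
    (hL : 0 < L) (hg : IsGrowthConst c R.h R.δ L) :
    ∃ τ > 0, ∀ (i : ℕ) (a b : ℝ), 1 ≤ i → t i = a → t (i + 1) = b → a + τ ≤ b := by
  obtain ⟨sl, hsl, hsb⟩ := exists_thresholdBound S.l_pos S.posDef S.sig_pos S.p_gt S.rs_pos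
  refine ⟨tau₃ L sl R.δ, tau₃_pos hL hsl S.δ_pos, fun i a b hi ha hb => ?_⟩
  have := (es.stage i a ha).tau₃_le S hi hL hg hsl hsb (hb ▸ es.first i a ha).isLeast
  linarith

/-- A sequence of event times with a uniform gap exceeds every time. -/
theorem exists_lt (es : IsEventSequence c R t₀ x₀ t x p) {τ : ℝ} (hτ : 0 < τ)
    (hgap : ∀ (i : ℕ) (a b : ℝ), 1 ≤ i → t i = a → t (i + 1) = b → a + τ ≤ b) (s : ℝ) :
    ∃ i : ℕ, (s : EReal) < t (i + 1) := by
  by_contra! hcon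
  have hreal : ∀ i, ∃ a : ℝ, t (i + 1) = a := by
    intro i
    rcases es.eq_top_or (i + 1) with h | h
    · exact absurd (top_le_iff.1 (h ▸ hcon i)) (EReal.coe_ne_top s)
    · exact h
  choose a ha using hreal
  have hgrow : ∀ n : ℕ, a 0 + n * τ ≤ a n := by
    intro n
    induction n with
    | zero => simp
    | succ n ih =>
      have := hgap (n + 1) (a n) (a (n + 1)) (by omega) (ha n) (ha (n + 1))
      push_cast
      linarith
  obtain ⟨n, hn⟩ := exists_nat_gt ((s - a 0) / τ)
  rw [div_lt_iff₀ hτ] at hn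
  have h1 := hcon n
  rw [ha, EReal.coe_le_coe_iff] at h1
  linarith [hgrow n]

theorem stageIndex_eq (es : IsEventSequence c R t₀ x₀ t x p) {i : ℕ} {s : ℝ}
    (h1 : t i ≤ s) (h2 : (s : EReal) < t (i + 1)) : stageIndex t s = i := by
  refine le_antisymm (Nat.sInf_le h2) ?_
  by_contra hlt
  have hlt' := not_le.1 hlt
  have hmem : (s : EReal) < t (stageIndex t s + 1) := Nat.sInf_mem (s := {i | (s : EReal) < t (i + 1)})
    ⟨i, h2⟩
  exact absurd (h1.trans_lt hmem) (not_lt.2 (es.monotone hlt'))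

theorem exists_stage (es : IsEventSequence c R t₀ x₀ t x p)
    (hcov : ∀ s : ℝ, ∃ i : ℕ, (s : EReal) < t (i + 1)) {s : ℝ} (hs : t₀ ≤ s) :
    ∃ (i : ℕ) (a : ℝ), t i = a ∧ a ≤ s ∧ (s : EReal) < t (i + 1) := by
  classical
  have hi := Nat.find_spec (hcov s)
  have hmin : ∀ j < Nat.find (hcov s), ¬ (s : EReal) < t (j + 1) :=
    fun j hj => Nat.find_min (hcov s) hj
  generalize Nat.find (hcov s) = i at hi hmin
  have hle : t i ≤ s := by
    rcases Nat.eq_zero_or_pos i with rfl | hi0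
    · rw [es.time_zero]; exact EReal.coe_le_coe_iff.2 hs
    · have := not_lt.1 (hmin (i - 1) (by omega))
      rwa [Nat.sub_add_cancel hi0] at this
  rcases es.eq_top_or i with h | ⟨a, ha⟩
  · exact absurd (top_le_iff.1 (h ▸ hle)) (EReal.coe_ne_top s)
  · exact ⟨i, a, ha, EReal.coe_le_coe_iff.1 (ha ▸ hle), hi⟩

theorem lt_succ (es : IsEventSequence c R t₀ x₀ t x p) {τ : ℝ} (hτ : 0 < τ)
    (hgap : ∀ (i : ℕ) (a b : ℝ), 1 ≤ i → t i = a → t (i + 1) = b → a + τ ≤ b) {i : ℕ} (hi : 1 ≤ i)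
    {a : ℝ} (ha : t i = a) : (a : EReal) < t (i + 1) := by
  rcases es.eq_top_or (i + 1) with h | ⟨b, hb⟩
  · rw [h]; exact EReal.coe_lt_top a
  · rw [hb, EReal.coe_lt_coe_iff]
    linarith [hgap i a b hi ha hb]

/-- The glued curve passes through the states `x i`. -/
theorem glue_event (es : IsEventSequence c R t₀ x₀ t x p) {τ : ℝ} (hτ : 0 < τ)
    (hgap : ∀ (i : ℕ) (a b : ℝ), 1 ≤ i → t i = a → t (i + 1) = b → a + τ ≤ b) {i : ℕ} {a : ℝ}
    (ha : t i = a) : p (stageIndex t a) a = x i := by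
  by_cases hlt : (a : EReal) < t (i + 1)
  · rw [es.stageIndex_eq ha.le hlt, es.start i a ha]
  · rcases Nat.eq_zero_or_pos i with rfl | hi
    -- the first event may occur at the initial time
    · have h1 : t 1 = a := le_antisymm (not_lt.1 hlt) (ha ▸ es.le_succ 0)
      rw [es.stageIndex_eq h1.le (es.lt_succ hτ hgap le_rfl h1), es.start 1 a h1,
        es.next 0 a a ha h1, es.start 0 a ha]
    · exact absurd (es.lt_succ hτ hgap hi ha) hlt

/-- The glued curve agrees with the `i`-th stage also at the end of that stage. -/
theorem glue_eq (es : IsEventSequence c R t₀ x₀ t x p) {τ : ℝ} (hτ : 0 < τ)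
    (hgap : ∀ (i : ℕ) (a b : ℝ), 1 ≤ i → t i = a → t (i + 1) = b → a + τ ≤ b) {i : ℕ} {a s : ℝ}
    (ha : t i = a) (has : a ≤ s) (hs : (s : EReal) ≤ t (i + 1)) :
    p (stageIndex t s) s = p i s := by
  rcases hs.lt_or_eq with hlt | heq
  · rw [es.stageIndex_eq (ha ▸ EReal.coe_le_coe_iff.2 has) hlt]
  · rw [es.glue_event hτ hgap heq.symm, es.next i a s ha heq.symm]

/-- Continuity on `[t₀, t i]` follows by induction on `i`, and the event times are unbounded. -/
theorem glue_continuousOn (es : IsEventSequence c R t₀ x₀ t x p) {τ : ℝ} (hτ : 0 < τ)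
    (hgap : ∀ (i : ℕ) (a b : ℝ), 1 ≤ i → t i = a → t (i + 1) = b → a + τ ≤ b) :
    ContinuousOn (fun s => p (stageIndex t s) s) {s : ℝ | t₀ ≤ s} := by
  have hcl : ∀ i, IsClosed {s : ℝ | (s : EReal) ≤ t i} := fun i =>
    isClosed_le continuous_coe_real_ereal continuous_const
  have hind : ∀ i, ContinuousOn (fun s => p (stageIndex t s) s)
      {s : ℝ | t₀ ≤ s ∧ (s : EReal) ≤ t i} := by
    intro i
    induction i with
    | zero =>
      refine (continuousOn_singleton _ t₀).mono fun s hs => ?_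
      exact le_antisymm (EReal.coe_le_coe_iff.1 (es.time_zero ▸ hs.2)) hs.1
    | succ i ih =>
      rcases es.eq_top_or i with h | ⟨a, ha⟩
      · rw [es.top i h, ← h]; exact ih
      · have h2 : ContinuousOn (fun s => p (stageIndex t s) s)
            {s : ℝ | a ≤ s ∧ (s : EReal) ≤ t (i + 1)} :=
          (es.stage i a ha).cont.continuousOn.congr fun s hs => es.glue_eq hτ hgap ha hs.1 hs.2
        refine (ih.union_of_isClosed h2 (isClosed_Ici.inter (hcl i))
          (isClosed_Ici.inter (hcl (i + 1)))).mono fun s hs => ?_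
        rcases le_total s a with hsa | hsa
        · exact Or.inl ⟨hs.1, ha ▸ EReal.coe_le_coe_iff.2 hsa⟩
        · exact Or.inr ⟨hsa, hs.2⟩
  intro s hs
  obtain ⟨i, hi⟩ := es.exists_lt hτ hgap s
  refine (hind (i + 1) s ⟨hs, hi.le⟩).mono_of_mem_nhdsWithin ?_
  have hopen : {r : ℝ | (r : EReal) < t (i + 1)} ∈ 𝓝 s :=
    (isOpen_lt continuous_coe_real_ereal continuous_const).mem_nhds hi
  filter_upwards [self_mem_nhdsWithin, mem_nhdsWithin_of_mem_nhds hopen] with r hr hr'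
  exact ⟨hr, hr'.le⟩

theorem glue_hasDerivWithinAt (es : IsEventSequence c R t₀ x₀ t x p) (S : Standing c R ρ κ) {τ : ℝ}
    (hτ : 0 < τ)
    (hgap : ∀ (i : ℕ) (a b : ℝ), 1 ≤ i → t i = a → t (i + 1) = b → a + τ ≤ b) {s : ℝ}
    (hs : t₀ ≤ s) :
    HasDerivWithinAt (fun s => p (stageIndex t s) s)
      (c.field (c.stageInput (stageIndex t s) (x (stageIndex t s))) (p (stageIndex t s) s))
      (Ici s) s := by
  obtain ⟨i, a, ha, has, hsi⟩ := es.exists_stage (es.exists_lt hτ hgap) hs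
  have hidx := es.stageIndex_eq (ha ▸ EReal.coe_le_coe_iff.2 has) hsi
  have hode := ((es.stage i a ha).ode s (es.piece_mem_Sv S ha has hsi.le)).hasDerivWithinAt
    (s := Ici s)
  rw [hidx]
  refine hode.congr_of_eventuallyEq ?_ (by rw [hidx])
  have hopen : {r : ℝ | (r : EReal) < t (i + 1)} ∈ 𝓝 s :=
    (isOpen_lt continuous_coe_real_ereal continuous_const).mem_nhds hsi
  filter_upwards [self_mem_nhdsWithin, mem_nhdsWithin_of_mem_nhds hopen] with r hr hr'
  exact es.glue_eq hτ hgap ha (has.trans hr) hr'.le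

/-- The curve glued from the stages is an execution for all times. -/
theorem isExecution (es : IsEventSequence c R t₀ x₀ t x p) (S : Standing c R ρ κ) {L : ℝ}
    (hL : 0 < L) (hg : IsGrowthConst c R.h R.δ L) :
    IsExecution c R t₀ ⊤ (fun s => (p (stageIndex t s) s).1) (fun s => (p (stageIndex t s) s).2)
      (fun s => c.stageInput (stageIndex t s) (x (stageIndex t s))) t := by
  obtain ⟨τ, hτ, hgap⟩ := es.exists_gap S hL hg
  have hcov := es.exists_lt hτ hgap
  have hcont : ContinuousOn (fun s => p (stageIndex t s) s)
      {s : ℝ | t₀ ≤ s ∧ (s : EReal) < ⊤} :=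
    (es.glue_continuousOn hτ hgap).mono fun s hs => hs.1
  constructor
  · exact EReal.coe_lt_top t₀
  · exact es.time_zero
  · refine (es.first 0 t₀ es.time_zero).congr (a := t₀) (fun s hs => hs.1) (fun s hs => hs.1)
      fun s hs hsτ => ?_
    have hp := es.glue_eq hτ hgap es.time_zero hs hsτ
    have h10 : ¬ 1 ≤ 0 := by omega
    simp only [mem_ofPred_eq, eventSet, hp, EReal.coe_lt_top, Loop.state, true_and, h10,
      IsEmpty.forall_iff]
  · intro i hi a ha
    refine (es.first i a ha).congr (a := a) (fun s hs => hs.1) (fun s hs => hs.1)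
      fun s hs hsτ => ?_
    have hp := es.glue_eq hτ hgap ha hs hsτ
    have hpa := es.glue_eq hτ hgap ha le_rfl (ha ▸ es.le_succ i)
    simp only [mem_ofPred_eq, eventSet, hp, hpa, EReal.coe_lt_top, Loop.state, true_and, hi,
      forall_const]
  · exact fun i _ h => es.top i h
  · exact fun s _ _ => hcov s
  · intro s hs _ hs1
    rw [es.stageIndex_eq (i := 0) (es.time_zero ▸ EReal.coe_le_coe_iff.2 hs) hs1]
    simp [Loop.stageInput]
  · intro i hi a ha s has _ hs1
    have hpa := es.glue_event hτ hgap ha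
    simp only [es.stageIndex_eq (ha ▸ EReal.coe_le_coe_iff.2 has) hs1, hpa, Loop.stageInput,
      if_pos hi]
  · exact continuous_fst.comp_continuousOn hcont
  · exact continuous_snd.comp_continuousOn hcont
  · exact fun s hs _ => (es.glue_hasDerivWithinAt S hτ hgap hs).fst
  · exact fun s hs _ => (es.glue_hasDerivWithinAt S hτ hgap hs).snd

end IsEventSequence

theorem exists_isExecution (hc : c.Admissible) (S : Standing c R ρ κ) {L : ℝ} (hL : 0 < L)
    (hg : IsGrowthConst c R.h R.δ L) (t₀ : ℝ) {y₀ : Vec k} {z₀ : Vec l}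
    (h0 : (y₀, c.wco R.h y₀ z₀) ∈ Sv k R.P R.δ) :
    ∃ (y : ℝ → Vec k) (z : ℝ → Vec l) (u : ℝ → Vec m) (t : ℕ → EReal),
      y t₀ = y₀ ∧ z t₀ = z₀ ∧ IsExecution c R t₀ ⊤ y z u t := by
  obtain ⟨t, x, p, es⟩ := exists_isEventSequence hc S t₀ (x₀ := (y₀, z₀)) h0
  obtain ⟨τ, hτ, hgap⟩ := es.exists_gap S hL hg
  have h1 := es.glue_event hτ hgap es.time_zero
  rw [es.state_zero] at h1
  exact ⟨_, _, _, t, by rw [h1], by rw [h1], es.isExecution S hL hg⟩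

end EventSequence

end EventTrig

theorem proposition4 {k l m : ℕ} (hk : 0 < k) (hl : 0 < l)
    (c : Loop k l m) (hc : c.Admissible)
    (ρ : ℝ) (h : Vec k → Vec l) (hh : c.IsCenterManifold ρ h)
    (hstab : LocallyAsympStable (c.reduced h) (Metric.ball 0 ρ))
    (hA₁ : c.A₁ = 0)
    (p k₅ k₆ : ℝ) (hp : 1 < p) (hk₅ : 0 < k₅) (hk₆ : 0 < k₆)
    (hg₅ : ∀ᶠ y in 𝓝 (0 : Vec k), ‖c.gc₁ y (h y)‖ ≤ k₅ * ‖y‖ ^ p)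
    (hg₆ : ∀ᶠ y in 𝓝 (0 : Vec k), inner ℝ y (c.gc₁ y (h y)) ≤ -k₆ * ‖y‖ ^ (p + 1))
    (P Q : Matrix (Fin l) (Fin l) ℝ) (hP : P.PosDef) (hQ : Q.PosDef)
    (hPQ : c.AKᵀ * P + P * c.AK = -Q)
    (sf : ℝ) (hsf : sf ∈ Ioo (0 : ℝ) 1)
    (sig : ℝ) (hsig : 0 < sig)
    (hsig' : sig * (2 * opNorm (P * c.B₂ * c.K₁) * Real.sqrt (lamMax P)) ≤
      (1 - sf) * lamMin Q * Real.sqrt (lamMin P)) :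
    ∃ δ₀ > 0, δ₀ ≤ ρ ∧ ∀ δ : ℝ, 0 < δ → δ ≤ δ₀ → ∀ rs : ℝ, 0 < rs →
      pairBall k l rs ⊆ Sv k P δ →
      let R : Rule k l := ⟨h, P, p, sig, δ, rs⟩
      -- every initial state in `S_v` admits an execution for all future time
      (∀ (t₀ : ℝ) (y₀ : Vec k) (z₀ : Vec l), (y₀, c.wco h y₀ z₀) ∈ Sv k P δ →
        ∃ (y : ℝ → Vec k) (z : ℝ → Vec l) (u : ℝ → Vec m) (t : ℕ → EReal),
          y t₀ = y₀ ∧ z t₀ = z₀ ∧ IsExecution c R t₀ ⊤ y z u t) ∧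
      -- uniform ultimate boundedness
      (∃ T₁ : ℝ, 0 ≤ T₁ ∧ ∀ (t₀ : ℝ) (T : EReal) (y : ℝ → Vec k) (z : ℝ → Vec l)
        (u : ℝ → Vec m) (t : ℕ → EReal), IsExecution c R t₀ T y z u t →
        (y t₀, c.wco h (y t₀) (z t₀)) ∈ Sv k P δ →
        ∀ s : ℝ, t₀ + T₁ ≤ s → (s : EReal) < T →
          (y s, c.wco h (y s) (z s)) ∈ pairBall k l rs) ∧
      -- uniform positive lower bound on the inter-event times
      (∃ L > 0, IsGrowthConst c h δ L) ∧
      (∃ sl > 0, IsThresholdBound R sl) ∧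
      (∀ L > 0, IsGrowthConst c h δ L → ∀ sl > 0, IsThresholdBound R sl →
        0 < tau₃ L sl δ ∧
        ∀ (t₀ : ℝ) (T : EReal) (y : ℝ → Vec k) (z : ℝ → Vec l)
          (u : ℝ → Vec m) (t : ℕ → EReal), IsExecution c R t₀ T y z u t →
          (y t₀, c.wco h (y t₀) (z t₀)) ∈ Sv k P δ →
          ∀ i : ℕ, 1 ≤ i → ∀ a b : ℝ, t i = (a : EReal) → t (i + 1) = (b : EReal) →
            tau₃ L sl δ ≤ b - a) := by
  obtain ⟨a, ha, δ₀, hδ₀, hδ₀ρ, hhle, ⟨L₀, hL₀, hg₀⟩, hdec⟩ :=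
    exists_radius_decay hl hc hh hA₁ hp hk₆ hg₆ hP hQ hPQ hsf hsig hsig'
  refine ⟨δ₀, hδ₀, hδ₀ρ.le, fun δ hδ hδδ₀ rs hrs hsub => ?_⟩
  intro R
  obtain ⟨κ, hκ, hκle⟩ := exists_pos_le_norm_add_rpow (k := k) (l := l) (p := p)
    (alpha₂inv_alpha₁_pos hl hP hrs) (by linarith)
  have hrlt : alpha₂inv P (alpha₁ P rs) < δ :=
    (alpha₂inv_alpha₁_lt hrs).trans_le (le_of_pairBall_subset hk hrs hsub)
  have hsampled : SampledDecay c R (a * κ) := by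
    intro y z y' z' s hact hS hyd hzd he
    obtain ⟨d, hd, hd'⟩ := hdec y z y' z' s (pairBall_mono hδδ₀ hact.1.1)
      (pairBall_mono hδδ₀ hS.1) hyd hzd he
    refine ⟨d, hd'.trans ?_, hd⟩
    have := mul_le_mul_of_nonneg_left (hκle _ _ (not_lt.1 hact.2)) ha.le
    linarith
  have S : Standing c R ρ (a * κ) :=
    { decay := hsampled
      manifold := hh
      h_le := fun y hy => hhle y (hy.trans_le hδδ₀)
      l_pos := hl
      posDef := hP
      κ_pos := mul_pos ha hκ
      δ_pos := hδ
      δ_lt := hδδ₀.trans_lt hδ₀ρ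
      p_gt := hp
      sig_pos := hsig
      rs_pos := hrs
      sub := hsub
      r₁_lt := hrlt }
  have hg : IsGrowthConst c h δ L₀ := fun y y' w w' hq hq' =>
    hg₀ y y' w w' (pairBall_mono hδδ₀ hq) (pairBall_mono hδδ₀ hq')
  refine ⟨fun t₀ y₀ z₀ h0 => exists_isExecution hc S hL₀ hg t₀ h0, ?_, ⟨L₀, hL₀, hg⟩,
    exists_thresholdBound hl hP hsig hp hrs, ?_⟩
  · refine ⟨alpha₁ P δ / (a * κ) + 1, ?_, fun t₀ T y z u t hx h0 s hs hsT =>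
      hx.mem_pairBall S h0 hs hsT⟩
    have : 0 < alpha₁ P δ := mul_pos (alpha₁_coeff_pos hl hP) hδ
    have := mul_pos ha hκ
    positivity
  · exact fun L hL hgL sl hsl hsb => ⟨tau₃_pos hL hsl hδ, fun t₀ T y z u t hx h0 i hi b b' hb hb' =>
      hx.tau₃_le hL hgL hδ hsl hsb (fun s hs hsT => hx.mem_Sv S h0 hs hsT) hi hb hb'⟩
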